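/- Let $M$ be a connected compact oriented smooth surface with non-empty boundary $\partial M$, and let $x:M\to\mathbb{R}^3$ be a smooth immersion with Gauss map $N$ (the unit normal field determined by the orientation). Let $r=\sqrt{x_1^2+x_2^2}$ be the distance to the $x_3$-axis, and suppose that $M$ is a stationary rotating surface, that is, for some constants $a,b\in\mathbb{R}$ the mean curvature $H$ (half the trace of $-dN$, so that $\Delta x=2HN$) satisfies $2H=ar^2+b$ on $M$. Let $\alpha$ be a parametrization by arc length $s$ of $\partial M$ (one closed curve for each boundary component) that orients $\partial M$ by the orientation induced from $M$, let $\nu$ be the inward unit conormal field along $\partial M$, let $E_3=(0,0,1)$ and $\nu_3=\langle\nu,E_3\rangle$. Then $$\int_{\partial M}(ar^2+2b)\,\langle x\wedge\alpha',E_3\rangle\,ds=-4\int_{\partial M}\nu_3\,ds .$$ In particular, $$a\int_{\partial M}r^2\,\langle x\wedge\alpha',E_3\rangle\,ds\le 4\bigl(L(\partial M)-b\,a(\partial M)\bigr),$$ where $L(\partial M)$ is the length of $\partial M$ and $a(\partial M)=\frac12\int_{\partial M}\langle x\wedge\alpha',E_3\rangle\,ds$ is the algebraic area of $\partial M$ (of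 its projection to a horizontal plane). -/

import Mathlib

open Set
open scoped Manifold ContDiff Matrix

noncomputable section

namespace RotatingSurface

/-- Euclidean three-space. -/
abbrev Space : Type := EuclideanSpace ℝ (Fin 3)

/-- The vector product `u ∧ v` of Euclidean three-space. -/
def cross (u v : Space) : Space := WithLp.toLp 2 (u.ofLp ⨯₃ v.ofLp)

/-- The vector `E₃ = (0, 0, 1)`, which spans the axis of rotation. -/
def E₃ : Space := EuclideanSpace.single 2 1

/-- The distance `r = √(x₁² + x₂²)` from a point to the `x₃`-axis. -/
def axisDist (q : Space) : ℝ := Real.sqrt (q 0 ^ 2 + q 1 ^ 2)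

section Surface

variable {M : Type*} [TopologicalSpace M] [ChartedSpace (EuclideanHalfSpace 2) M]

/-- The image `dx_p(e_i)` of the `i`-th coordinate vector of the preferred chart at `p` under
the differential of a map `x` from a surface with boundary to three-space. The preferred chart has
values in the half-plane `{y | 0 ≤ y 0}`: at a boundary point, `e_1` is tangent to the boundary and
`e_0` points into the surface. -/
def coordVec (x : M → Space) (p : M) (i : Fin 2) : Space :=
  mfderiv (𝓡∂ 2) 𝓘(ℝ, Space) x p (EuclideanSpace.single i (1 : ℝ) : EuclideanSpace ℝ (Fin 2))

/-- The matrix of the first fundamental form `⟨dx u, dx v⟩` in the coordinate basis at `p`. -/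
def firstFundamentalForm (x : M → Space) (p : M) : Matrix (Fin 2) (Fin 2) ℝ :=
  Matrix.of fun i j => inner ℝ (coordVec x p i) (coordVec x p j)

/-- The matrix of the second fundamental form `-⟨dN u, dx v⟩` in the coordinate basis at `p`. -/
def secondFundamentalForm (x N : M → Space) (p : M) : Matrix (Fin 2) (Fin 2) ℝ :=
  Matrix.of fun i j => -inner ℝ (coordVec N p i) (coordVec x p j)

/-- The mean curvature `H`, half the trace of the second fundamental form with respect to the first
one. With this sign, `H > 0` for a round sphere with the inward normal, and `Δ x = 2 H N`. -/
def meanCurvature (x N : M → Space) (p : M) : ℝ :=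
  (1 / 2) * ((firstFundamentalForm x p)⁻¹ * secondFundamentalForm x N p).trace

/-- `x : M → ℝ³` is a smooth immersion of the surface with boundary `M`, the smooth field `N` is a
Gauss map (a unit normal field; its choice is the choice of an orientation of `M`, for which a basis
`(u, v)` of a tangent plane is positive if `dx u ∧ dx v` is a positive multiple of `N`), and the
mean curvature satisfies `2 H = a r² + b`. -/
structure IsStationaryRotating (x N : M → Space) (a b : ℝ) : Prop where
  smooth : ContMDiff (𝓡∂ 2) 𝓘(ℝ, Space) ∞ x
  immersion : ∀ p, Function.Injective (mfderiv (𝓡∂ 2) 𝓘(ℝ, Space) x p)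
  gauss_smooth : ContMDiff (𝓡∂ 2) 𝓘(ℝ, Space) ∞ N
  gauss_unit : ∀ p, ‖N p‖ = 1
  gauss_normal : ∀ p (v : TangentSpace (𝓡∂ 2) p),
    inner ℝ (N p) (mfderiv (𝓡∂ 2) 𝓘(ℝ, Space) x p v : Space) = 0
  laplace : ∀ p, 2 * meanCurvature x N p = a * axisDist (x p) ^ 2 + b

/-- The inward unit conormal `ν` at a boundary point `p`: the normalized component of the inward
vector `dx_p(e_0)` that is orthogonal to the boundary direction `dx_p(e_1)`. -/
def inwardConormal (x : M → Space) (p : M) : Space :=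
  let w : Space := coordVec x p 0 -
    (inner ℝ (coordVec x p 1) (coordVec x p 0) /
      inner ℝ (coordVec x p 1) (coordVec x p 1) : ℝ) • coordVec x p 1
  ‖w‖⁻¹ • w

/-- A parametrization by arc length of `∂M` that induces on `∂M` the boundary orientation: finitely
many smooth closed curves `γ i` of lengths `ℓ i`, each run through once, which together cover `∂M`
exactly once, such that `α i = x ∘ γ i` has unit speed and (outward conormal, `α'`) is a positive
basis of the tangent plane. -/
structure BoundaryParametrization (x N : M → Space) where
  n : ℕ
  ℓ : Fin n → ℝ
  ℓ_pos : ∀ i, 0 < ℓ i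
  γ : Fin n → ℝ → M
  smooth : ∀ i, ContMDiff 𝓘(ℝ, ℝ) (𝓡∂ 2) ∞ (γ i)
  periodic : ∀ i, Function.Periodic (γ i) (ℓ i)
  bijOn : BijOn (fun q : Fin n × ℝ => γ q.1 q.2) {q | q.2 ∈ Ico 0 (ℓ q.1)} ((𝓡∂ 2).boundary M)
  unit_speed : ∀ i s, ‖deriv (fun t => x (γ i t)) s‖ = 1
  oriented : ∀ i s,
    0 < inner ℝ (cross (-inwardConormal x (γ i s)) (deriv (fun t => x (γ i t)) s)) (N (γ i s))

namespace BoundaryParametrization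

variable {x N : M → Space} (P : BoundaryParametrization x N)

/-- The boundary curves `α i = x ∘ γ i` in three-space. -/
def α (i : Fin P.n) (s : ℝ) : Space := x (P.γ i s)

/-- The unit tangent vector `α'`. -/
def α' (i : Fin P.n) (s : ℝ) : Space := deriv (P.α i) s

/-- The inward unit conormal `ν` along the boundary curves. -/
def ν (i : Fin P.n) (s : ℝ) : Space := inwardConormal x (P.γ i s)

/-- The integral `∫_{∂M} f ds` with respect to arc length. -/
def integral (f : Fin P.n → ℝ → ℝ) : ℝ := ∑ i, ∫ s in (0 : ℝ)..P.ℓ i, f i s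

/-- The length `L(∂M)`. -/
def length : ℝ := P.integral fun _ _ => 1

/-- The algebraic area `a(∂M) = (1/2) ∫_{∂M} ⟨α ∧ α', E₃⟩ ds`, that is, the algebraic area enclosed
by the orthogonal projection of `∂M` to a horizontal plane. -/
def algebraicArea : ℝ := (1 / 2) * P.integral fun i s => inner ℝ (cross (P.α i s) (P.α' i s)) E₃

end BoundaryParametrization

end Surface

end RotatingSurface

end

noncomputable section

namespace RotatingSurface

open MeasureTheory Filter Topology

/-! The identity is Stokes' theorem for the 1-form ω = ⟨E₃ ∧ ((a r² + 2b) x + 4N), dx⟩ on M. By the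
symmetry of the triple product, ω(v) = (a r² + 2b)⟨x ∧ v, E₃⟩ + 4⟨N ∧ v, E₃⟩ for tangent v. Along ∂M
the inward conormal is N ∧ α' (`BoundaryParametrization.ν_eq`), so ω(α') is the sum of the two
integrands of the theorem.

The form is closed. In the first term, d((a r² + 2b)(x₁dx₂ − x₂dx₁)) = 4(a r² + b) dx₁ ∧ dx₂. In the
second, the trace of the shape operator gives dN(e₀) ∧ dx(e₁) − dN(e₁) ∧ dx(e₀) = −2H dx(e₀) ∧
dx(e₁) (`IsStationaryRotating.cross_diff_normal`), hence a contribution of −4·2H dx₁ ∧ dx₂. The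
equation 2H = a r² + b makes them cancel (`IsStationaryRotating.fluxField_closed`). The inequality
then follows from ν₃ ≥ −1.

Stokes' theorem on M (`BoundaryParametrization.integral_closed_oneForm`) is built from the
half-plane by a partition of unity ρᵢ subordinate to charts. Since ω is closed, d(ρᵢω) = dρᵢ ∧ ω, so
the boundary integral of ρᵢω is an integral of dρᵢ ∧ ω over one chart. These integrals add up to
zero because Σ dρᵢ = 0. To add integrals from different charts, dρᵢ ∧ ω is divided by the area form;
the resulting function can be integrated against area in any chart that contains its support
(`areaIntegral_eq_of_support`). -/

/-! ### Linear algebra of 2-forms on the plane. -/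

/-- The Euclidean plane, the model space of surfaces with boundary. -/
abbrev Plane : Type := EuclideanSpace ℝ (Fin 2)

/-- The standard basis of the plane. -/
abbrev stdVec (i : Fin 2) : Plane := EuclideanSpace.single i (1 : ℝ)

lemma plane_eq (v : Plane) : v = v 0 • stdVec 0 + v 1 • stdVec 1 := by
  ext i; fin_cases i <;> simp

lemma map_plane {V : Type*} [NormedAddCommGroup V] [NormedSpace ℝ V] (L : Plane →L[ℝ] V)
    (v : Plane) : L v = v 0 • L (stdVec 0) + v 1 • L (stdVec 1) := by
  conv_lhs => rw [plane_eq v]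
  simp only [map_add, map_smul]

lemma det_plane (A : Plane →L[ℝ] Plane) :
    A.det = A (stdVec 0) 0 * A (stdVec 1) 1 - A (stdVec 1) 0 * A (stdVec 0) 1 := by
  rw [ContinuousLinearMap.det, ← LinearMap.det_toMatrix (EuclideanSpace.basisFun (Fin 2) ℝ).toBasis,
    Matrix.det_fin_two]
  simp [LinearMap.toMatrix_apply]

/-- The exterior product of two linear forms on the plane, evaluated on the standard basis. -/
def wedge (l m : Plane →L[ℝ] ℝ) : ℝ := l (stdVec 0) * m (stdVec 1) - l (stdVec 1) * m (stdVec 0)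

lemma wedge_comp (l m : Plane →L[ℝ] ℝ) (A : Plane →L[ℝ] Plane) :
    wedge (l.comp A) (m.comp A) = A.det * wedge l m := by
  simp only [wedge, ContinuousLinearMap.comp_apply]
  rw [map_plane l (A (stdVec 0)), map_plane m (A (stdVec 0)), map_plane l (A (stdVec 1)),
    map_plane m (A (stdVec 1)), det_plane]
  simp only [smul_eq_mul]; ring

lemma inner_cross (u v w : Space) : inner ℝ (cross u v) w =
    (u 1 * v 2 - u 2 * v 1) * w 0 + (u 2 * v 0 - u 0 * v 2) * w 1 +
      (u 0 * v 1 - u 1 * v 0) * w 2 := by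
  simp [cross, PiLp.inner_apply, Fin.sum_univ_three, cross_apply]; ring

/-- The area form: the value on the standard basis of the 2-form `(u, v) ↦ ⟨L u ∧ L v, n⟩`. -/
def areaForm (L : Plane →L[ℝ] Space) (n : Space) : ℝ :=
  inner ℝ (cross (L (stdVec 0)) (L (stdVec 1))) n

lemma areaForm_apply (L : Plane →L[ℝ] Space) (n : Space) (u v : Plane) :
    inner ℝ (cross (L u) (L v)) n = (u 0 * v 1 - u 1 * v 0) * areaForm L n := by
  rw [areaForm, map_plane L u, map_plane L v]
  simp only [inner_cross, PiLp.add_apply, PiLp.smul_apply, smul_eq_mul]; ring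

lemma areaForm_comp (L : Plane →L[ℝ] Space) (A : Plane →L[ℝ] Plane) (n : Space) :
    areaForm (L.comp A) n = A.det * areaForm L n := by
  rw [det_plane, areaForm, ContinuousLinearMap.comp_apply, ContinuousLinearMap.comp_apply,
    areaForm_apply]
  ring

/-! ### Stokes' theorem on the half-plane. -/

/-- Stokes' theorem on the right half-plane for a compactly supported 1-form `w₀ dx + w₁ dy`. -/
lemma stokes_prod (w₀ w₁ : ℝ × ℝ → ℝ) (w₀' w₁' : ℝ × ℝ → ℝ × ℝ →L[ℝ] ℝ) (g : ℝ × ℝ → ℝ) {ρ : ℝ}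
    (hρ : 0 < ρ)
    (hc₀ : ContinuousOn w₀ {p | 0 ≤ p.1}) (hc₁ : ContinuousOn w₁ {p | 0 ≤ p.1})
    (hd₀ : ∀ p : ℝ × ℝ, 0 < p.1 → HasFDerivAt w₀ (w₀' p) p)
    (hd₁ : ∀ p : ℝ × ℝ, 0 < p.1 → HasFDerivAt w₁ (w₁' p) p)
    (hg : ∀ p : ℝ × ℝ, 0 < p.1 → g p = w₁' p (1, 0) - w₀' p (0, 1))
    (hi : IntegrableOn g {p | 0 ≤ p.1})
    (hz₀ : ∀ p : ℝ × ℝ, ρ ≤ ‖p‖ → w₀ p = 0) (hz₁ : ∀ p : ℝ × ℝ, ρ ≤ ‖p‖ → w₁ p = 0)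
    (hzg : ∀ p : ℝ × ℝ, ρ ≤ ‖p‖ → g p = 0) :
    ∫ p in {p : ℝ × ℝ | 0 ≤ p.1}, g p = -∫ t, w₁ (0, t) := by
  have hsub : Icc ((0 : ℝ), -ρ) (ρ, ρ) ⊆ {p | 0 ≤ p.1} := fun p hp => hp.1.1
  have hae : ∀ᵐ p ∂(volume.restrict (Icc ((0 : ℝ), -ρ) (ρ, ρ))),
      w₁' p (1, 0) + (-w₀' p) (0, 1) = g p := by
    -- The formula for `g` is only known in the open half-plane; the boundary line is a null set.
    have h0 : ∀ᵐ p : ℝ × ℝ, p.1 ≠ 0 := by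
      have : volume ({p : ℝ × ℝ | p.1 = 0}) = 0 := by
        have h : {p : ℝ × ℝ | p.1 = 0} = {0} ×ˢ univ := by ext; simp
        rw [h, Measure.volume_eq_prod, Measure.prod_prod]; simp
      exact measure_eq_zero_iff_ae_notMem.1 this
    filter_upwards [ae_restrict_of_ae h0, ae_restrict_mem measurableSet_Icc] with p hp hp'
    rw [hg p (lt_of_le_of_ne hp'.1.1 (Ne.symm hp))]
    simp [sub_eq_add_neg]
  -- Divergence theorem for the field (w₁, −w₀) on [0, ρ] × [−ρ, ρ]. Three sides lie where the form
  -- vanishes, so only the side on the boundary line contributes.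
  have key := integral_divergence_prod_Icc_of_hasFDerivAt_off_countable_of_le w₁ (fun p => -w₀ p)
    w₁' (fun p => -w₀' p) (0, -ρ) (ρ, ρ) ⟨hρ.le, by simp; linarith⟩ ∅ countable_empty
    (hc₁.mono hsub) (hc₀.mono hsub).neg (fun p hp => hd₁ p hp.1.1.1)
    (fun p hp => (hd₀ p hp.1.1.1).neg) ((integrable_congr hae).2 (hi.mono_set hsub))
  rw [integral_congr_ae hae] at key
  have hn : ∀ t : ℝ, ρ ≤ |t| → ∀ s : ℝ, ρ ≤ ‖(s, t)‖ ∧ ρ ≤ ‖(t, s)‖ := fun t ht s =>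
    ⟨ht.trans (by simp [Prod.norm_def]), ht.trans (by simp [Prod.norm_def])⟩
  have habs : |ρ| = ρ := abs_of_pos hρ
  have e1 : ∀ s, w₀ (s, ρ) = 0 := fun s => hz₀ _ (hn ρ habs.ge s).1
  have e2 : ∀ s, w₀ (s, -ρ) = 0 := fun s => hz₀ _ (hn (-ρ) (by rw [abs_neg, habs]) s).1
  have e3 : ∀ s, w₁ (ρ, s) = 0 := fun s => hz₁ _ (hn ρ habs.ge s).2
  simp only [e1, e2, e3, neg_zero, intervalIntegral.integral_zero, sub_zero, zero_add, zero_sub]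
    at key
  rw [setIntegral_eq_of_subset_of_forall_sdiff_eq_zero
    (measurableSet_le measurable_const measurable_fst) hsub, key]
  · rw [intervalIntegral.integral_of_le (by linarith), ← integral_indicator measurableSet_Ioc]
    refine congrArg Neg.neg (integral_congr_ae (Eventually.of_forall fun t => ?_))
    by_cases ht : t ∈ Ioc (-ρ) ρ
    · simp [ht]
    · simp only [ht, not_false_eq_true, indicator_of_notMem]
      refine (hz₁ _ (hn t ?_ 0).1).symm
      rw [mem_Ioc, not_and_or, not_lt, not_le] at ht
      rcases ht with h | h
      · exact le_abs.2 (Or.inr (by linarith))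
      · exact le_abs.2 (Or.inl h.le)
  · rintro p ⟨hp, hp'⟩
    apply hzg
    by_contra! hlt
    rw [Prod.norm_def, max_lt_iff, Real.norm_eq_abs, Real.norm_eq_abs, abs_lt, abs_lt] at hlt
    exact hp' ⟨⟨hp, hlt.2.1.le⟩, ⟨hlt.1.2.le, hlt.2.2.le⟩⟩

/-- The identification of `ℝ × ℝ` with the Euclidean plane. -/
def mkPlane : ℝ × ℝ →L[ℝ] Plane :=
  (ContinuousLinearMap.fst ℝ ℝ ℝ).smulRight (stdVec 0) +
    (ContinuousLinearMap.snd ℝ ℝ ℝ).smulRight (stdVec 1)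

@[simp] lemma mkPlane_zero (p : ℝ × ℝ) : mkPlane p 0 = p.1 := by simp [mkPlane]

@[simp] lemma mkPlane_one (p : ℝ × ℝ) : mkPlane p 1 = p.2 := by simp [mkPlane]

lemma mkPlane_coord (v : Plane) : mkPlane (v 0, v 1) = v := by
  ext i; fin_cases i <;> simp

lemma norm_le_norm_mkPlane (p : ℝ × ℝ) : ‖p‖ ≤ ‖mkPlane p‖ := by
  rw [Prod.norm_def]
  refine max_le ?_ ?_
  · simpa using PiLp.norm_apply_le (mkPlane p) 0
  · simpa using PiLp.norm_apply_le (mkPlane p) 1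

lemma measurePreserving_mkPlane : MeasurePreserving mkPlane := by
  have h := (EuclideanSpace.volume_preserving_symm_measurableEquiv_toLp (Fin 2)).symm.comp
    ((volume_preserving_finTwoArrow ℝ).symm)
  have he : (mkPlane : ℝ × ℝ → Plane) = (⇑(MeasurableEquiv.toLp 2 (Fin 2 → ℝ)).symm.symm ∘
      ⇑MeasurableEquiv.finTwoArrow.symm) := by
    funext p
    ext i; fin_cases i <;> simp
  rw [he]; exact h

lemma measurableEmbedding_mkPlane : MeasurableEmbedding mkPlane := by
  refine (Continuous.measurableEmbedding mkPlane.continuous fun p q h => ?_)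
  rw [Prod.ext_iff, ← mkPlane_zero p, ← mkPlane_one p, h]; simp

lemma range_model : range (𝓡∂ 2) = {y : Plane | 0 ≤ y 0} :=
  range_modelWithCornersEuclideanHalfSpace 2

lemma interior_range_model : interior (range (𝓡∂ 2)) = {y : Plane | 0 < y 0} :=
  interior_range_modelWithCornersEuclideanHalfSpace 2

/-- Stokes' theorem for a 1-form with compact support on a relatively open subset of the
half-plane. -/
lemma stokes_halfPlane {T K U : Set Plane} (hU : IsOpen U) (hT : T = U ∩ range (𝓡∂ 2))
    (hK : IsCompact K) (hKT : K ⊆ T) (w₀ w₁ g : Plane → ℝ)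
    (hc₀ : ContinuousOn w₀ T) (hc₁ : ContinuousOn w₁ T) (hcg : ContinuousOn g T)
    (hd₀ : ∀ y ∈ T, 0 < y 0 → DifferentiableAt ℝ w₀ y)
    (hd₁ : ∀ y ∈ T, 0 < y 0 → DifferentiableAt ℝ w₁ y)
    (hg : ∀ y ∈ T, 0 < y 0 → g y = fderiv ℝ w₁ y (stdVec 0) - fderiv ℝ w₀ y (stdVec 1))
    (hz₀ : ∀ y ∈ T \ K, w₀ y = 0) (hz₁ : ∀ y ∈ T \ K, w₁ y = 0) (hzg : ∀ y ∈ T \ K, g y = 0) :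
    ∫ y in T, g y = -∫ t in {t : ℝ | mkPlane (0, t) ∈ T}, w₁ (mkPlane (0, t)) := by
  classical
  rw [range_model] at hT
  -- Extension by zero keeps the regularity on the half-plane: near a point of `T` the extension is
  -- `w` itself, and near a point off the closed set `K` it is zero.
  have hind : ∀ w : Plane → ℝ, (∀ y ∈ T \ K, w y = 0) → ∀ y ∉ K, T.indicator w y = 0 := by
    intro w hw y hy
    by_cases hyT : y ∈ T
    · rw [indicator_of_mem hyT, hw y ⟨hyT, hy⟩]
    · exact indicator_of_notMem hyT w
  have hoff : ∀ w : Plane → ℝ, (∀ y ∈ T \ K, w y = 0) → ∀ y ∉ K, T.indicator w =ᶠ[𝓝 y] 0 :=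
    fun w hw y hy => by
      filter_upwards [hK.isClosed.isOpen_compl.mem_nhds hy] with z hz using hind w hw z hz
  have hon : ∀ w : Plane → ℝ, ∀ y ∈ T, T.indicator w =ᶠ[𝓝[{y | 0 ≤ y 0}] y] w := by
    intro w y hy
    rw [hT] at hy
    filter_upwards [inter_mem_nhdsWithin {y : Plane | 0 ≤ y 0} (hU.mem_nhds hy.1)] with z hz
    rw [indicator_of_mem]
    rw [hT]; exact ⟨hz.2, hz.1⟩
  have hcont : ∀ w : Plane → ℝ, ContinuousOn w T → (∀ y ∈ T \ K, w y = 0) →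
      ContinuousOn (T.indicator w) {y | 0 ≤ y 0} := by
    intro w hw hz y hy
    by_cases hyK : y ∈ K
    · have hyT := hKT hyK
      refine ContinuousWithinAt.congr_of_eventuallyEq ?_ (hon w y hyT) (indicator_of_mem hyT w)
      have := hw y hyT
      rw [hT] at this hyT
      rw [inter_comm] at this
      exact (continuousWithinAt_inter (hU.mem_nhds hyT.1)).1 this
    · exact (continuousAt_const.congr (hoff w hz y hyK).symm).continuousWithinAt
  have hon' : ∀ w : Plane → ℝ, ∀ y ∈ T, 0 < y 0 → T.indicator w =ᶠ[𝓝 y] w := by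
    intro w y hy h0
    have h := hon w y hy
    rwa [nhdsWithin_eq_nhds.2] at h
    have ho : IsOpen {z : Plane | 0 < z 0} := isOpen_lt continuous_const (by fun_prop)
    exact mem_of_superset (ho.mem_nhds h0) fun z (hz : 0 < z 0) => hz.le
  have hdiff : ∀ w : Plane → ℝ, (∀ y ∈ T, 0 < y 0 → DifferentiableAt ℝ w y) →
      (∀ y ∈ T \ K, w y = 0) → ∀ y : Plane, 0 < y 0 → DifferentiableAt ℝ (T.indicator w) y := by
    intro w hw hz y h0
    by_cases hyT : y ∈ T
    · exact (hw y hyT h0).congr_of_eventuallyEq (hon' w y hyT h0)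
    · exact (differentiableAt_const (0 : ℝ)).congr_of_eventuallyEq
        (hoff w hz y fun h => hyT (hKT h))
  have hmeas : MeasurableSet T := by
    rw [hT]
    refine hU.measurableSet.inter (measurableSet_le measurable_const ?_)
    exact (by fun_prop : Continuous fun y : Plane => y 0).measurable
  have hmk : Continuous fun t : ℝ => mkPlane (0, t) := by fun_prop
  obtain ⟨ρ, hρ, hKρ⟩ := hK.isBounded.subset_ball_lt 0 0
  have hfar : ∀ w : Plane → ℝ, (∀ y ∈ T \ K, w y = 0) → ∀ p : ℝ × ℝ, ρ ≤ ‖p‖ →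
      T.indicator w (mkPlane p) = 0 := by
    intro w hz p hp
    refine hind w hz _ fun h => ?_
    have := hKρ h
    rw [mem_ball_zero_iff] at this
    linarith [norm_le_norm_mkPlane p]
  have hpre : mkPlane ⁻¹' {y | 0 ≤ y 0} = {p : ℝ × ℝ | 0 ≤ p.1} := by ext; simp
  have hmaps : MapsTo mkPlane {p : ℝ × ℝ | 0 ≤ p.1} {y | 0 ≤ y 0} := fun p hp => by simpa using hp
  have hTsub : T ⊆ {y | 0 ≤ y 0} := by rw [hT]; exact inter_subset_right
  have hint : IntegrableOn (T.indicator g) {y | 0 ≤ y 0} := by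
    have h1 : IntegrableOn (T.indicator g) K :=
      ((hcont g hcg hzg).mono (hKT.trans hTsub)).integrableOn_compact hK
    exact h1.of_forall_sdiff_eq_zero
      (measurableSet_le measurable_const
        (by fun_prop : Continuous fun y : Plane => y 0).measurable) fun y hy => hind g hzg y hy.2
  have hfd : ∀ w : Plane → ℝ, (∀ y ∈ T, 0 < y 0 → DifferentiableAt ℝ w y) →
      (∀ y ∈ T \ K, w y = 0) → ∀ p : ℝ × ℝ, 0 < p.1 →
      HasFDerivAt (T.indicator w ∘ mkPlane)
        ((fderiv ℝ (T.indicator w) (mkPlane p)).comp mkPlane) p := fun w hw hz p hp =>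
    (hdiff w hw hz (mkPlane p) (by simpa using hp)).hasFDerivAt.comp p mkPlane.hasFDerivAt
  have hm0 : mkPlane (1, 0) = stdVec 0 := by ext i; fin_cases i <;> simp
  have hm1 : mkPlane (0, 1) = stdVec 1 := by ext i; fin_cases i <;> simp
  have key := stokes_prod (T.indicator w₀ ∘ mkPlane) (T.indicator w₁ ∘ mkPlane) _ _
    (T.indicator g ∘ mkPlane) hρ
    ((hcont w₀ hc₀ hz₀).comp mkPlane.continuous.continuousOn hmaps)
    ((hcont w₁ hc₁ hz₁).comp mkPlane.continuous.continuousOn hmaps)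
    (hfd w₀ hd₀ hz₀) (hfd w₁ hd₁ hz₁) ?_ ?_ (hfar w₀ hz₀) (hfar w₁ hz₁) (hfar g hzg)
  · rw [← hpre] at key
    simp only [Function.comp_apply] at key
    rw [measurePreserving_mkPlane.setIntegral_preimage_emb measurableEmbedding_mkPlane,
      setIntegral_indicator hmeas, inter_eq_self_of_subset_right hTsub] at key
    rw [key]
    exact congrArg Neg.neg (integral_indicator (hmk.measurable hmeas))
  · intro p hp
    simp only [Function.comp_apply, ContinuousLinearMap.comp_apply, hm0, hm1]
    have hp' : 0 < mkPlane p 0 := by simpa using hp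
    by_cases hpT : mkPlane p ∈ T
    · rw [(hon' w₁ _ hpT hp').fderiv_eq, (hon' w₀ _ hpT hp').fderiv_eq, indicator_of_mem hpT,
        hg _ hpT hp']
    · have hpK : mkPlane p ∉ K := fun h => hpT (hKT h)
      rw [(hoff w₁ hz₁ _ hpK).fderiv_eq, (hoff w₀ hz₀ _ hpK).fderiv_eq, indicator_of_notMem hpT]
      simp
  · rw [← hpre]
    exact (measurePreserving_mkPlane.integrableOn_comp_preimage measurableEmbedding_mkPlane).2 hint

lemma two_le_infty : (2 : WithTop ℕ∞) ≤ ∞ :=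
  WithTop.coe_le_coe.2 (le_top : (2 : ℕ∞) ≤ ⊤)

/-- Stokes' theorem for the product of a compactly supported function `f` with the closed 1-form
`⟨F, dX⟩` on a relatively open subset of the half-plane. -/
lemma stokes_closed_form {T K U : Set Plane} (hU : IsOpen U) (hT : T = U ∩ range (𝓡∂ 2))
    (hu : UniqueDiffOn ℝ T) (hK : IsCompact K) (hKT : K ⊆ T) {f : Plane → ℝ} {F X : Plane → Space}
    (hf : ContDiffOn ℝ ∞ f T) (hF : ContDiffOn ℝ ∞ F T) (hX : ContDiffOn ℝ ∞ X T)
    (hfK : ∀ y ∈ T \ K, f y = 0)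
    (hcl : ∀ y ∈ T, (inner ℝ (fderivWithin ℝ F T y (stdVec 0)) (fderivWithin ℝ X T y (stdVec 1)) : ℝ)
      = inner ℝ (fderivWithin ℝ F T y (stdVec 1)) (fderivWithin ℝ X T y (stdVec 0))) :
    ∫ y in T, wedge (fderivWithin ℝ f T y) ((innerSL ℝ (F y)).comp (fderivWithin ℝ X T y)) =
      -∫ t in {t : ℝ | mkPlane (0, t) ∈ T}, f (mkPlane (0, t)) *
        inner ℝ (F (mkPlane (0, t))) (fderivWithin ℝ X T (mkPlane (0, t)) (stdVec 1)) := by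
  have hdX := hX.continuousOn_fderivWithin hu (by simp)
  have hdf := hf.continuousOn_fderivWithin hu (by simp)
  have hnhds : ∀ y ∈ T, 0 < y 0 → T ∈ 𝓝 y := by
    intro y hy h0
    have ho : IsOpen {z : Plane | 0 < z 0} := isOpen_lt continuous_const (by fun_prop)
    rw [hT] at hy ⊢
    refine inter_mem (hU.mem_nhds hy.1) (mem_of_superset (ho.mem_nhds h0) fun z (hz : 0 < z 0) => ?_)
    rw [range_model]; exact hz.le
  have heq : ∀ y ∈ T, 0 < y 0 → fderivWithin ℝ X T =ᶠ[𝓝 y] fderiv ℝ X := by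
    intro y hy h0
    filter_upwards [eventually_mem_nhds_iff.2 (hnhds y hy h0)] with z hz
    exact fderivWithin_of_mem_nhds hz
  have hfd : ∀ y ∈ T, 0 < y 0 → DifferentiableAt ℝ f y := fun y hy h0 =>
    (hf.contDiffAt (hnhds y hy h0)).differentiableAt (by simp)
  have hFd : ∀ y ∈ T, 0 < y 0 → DifferentiableAt ℝ F y := fun y hy h0 =>
    (hF.contDiffAt (hnhds y hy h0)).differentiableAt (by simp)
  have hXd : ∀ y ∈ T, 0 < y 0 → DifferentiableAt ℝ (fderiv ℝ X) y := fun y hy h0 =>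
    ((hX.contDiffAt (hnhds y hy h0)).fderiv_right (m := 1)
      (by simpa [one_add_one_eq_two] using two_le_infty)).differentiableAt
      (by simp)
  have hw : ∀ (v : Plane) (y) (hy : y ∈ T) (h0 : 0 < y 0),
      HasFDerivAt (fun z => f z * inner ℝ (F z) (fderivWithin ℝ X T z v))
      (f y • (fderivInnerCLM ℝ (F y, fderiv ℝ X y v)).comp
        ((fderiv ℝ F y).prod ((fderiv ℝ (fderiv ℝ X) y).flip v)) +
        (inner ℝ (F y) (fderiv ℝ X y v) : ℝ) • fderiv ℝ f y) y := by
    intro v y hy h0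
    have h1 : HasFDerivAt (fun z => fderiv ℝ X z v) ((fderiv ℝ (fderiv ℝ X) y).flip v) y := by
      simpa using (hXd y hy h0).hasFDerivAt.clm_apply (hasFDerivAt_const v y)
    have h2 := (hfd y hy h0).hasFDerivAt.mul (((hFd y hy h0).hasFDerivAt).inner ℝ h1)
    refine h2.congr_of_eventuallyEq ?_
    filter_upwards [heq y hy h0] with z hz
    rw [hz]; rfl
  have hcw : ∀ v : Plane, ContinuousOn (fun z => f z * (inner ℝ (F z) (fderivWithin ℝ X T z v) : ℝ)) T :=
    fun v => hf.continuousOn.mul (hF.continuousOn.inner (hdX.clm_apply continuousOn_const))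
  refine stokes_halfPlane hU hT hK hKT
    (fun z => f z * inner ℝ (F z) (fderivWithin ℝ X T z (stdVec 0)))
    (fun z => f z * inner ℝ (F z) (fderivWithin ℝ X T z (stdVec 1))) _ (hcw _) (hcw _) ?_
    (fun y hy h0 => (hw _ y hy h0).differentiableAt)
    (fun y hy h0 => (hw _ y hy h0).differentiableAt) ?_
    (fun y hy => by simp [hfK y hy]) (fun y hy => by simp [hfK y hy]) ?_
  · have hi : ∀ v, ContinuousOn (fun y => (inner ℝ (F y) (fderivWithin ℝ X T y v) : ℝ)) T :=
      fun v => hF.continuousOn.inner (hdX.clm_apply continuousOn_const)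
    exact ((hdf.clm_apply continuousOn_const).mul (hi _)).sub
      ((hdf.clm_apply continuousOn_const).mul (hi _))
  · intro y hy h0
    -- The exterior derivative of ⟨F, dX⟩ has two parts: the one with second derivatives of `X`
    -- cancels by their symmetry, the one with ⟨dF, dX⟩ by `hcl`. Only df ∧ ⟨F, dX⟩ remains.
    have hsymm : fderiv ℝ (fderiv ℝ X) y (stdVec 0) (stdVec 1) =
        fderiv ℝ (fderiv ℝ X) y (stdVec 1) (stdVec 0) :=
      (hX.contDiffAt (hnhds y hy h0)).isSymmSndFDerivAt
        (by simpa using two_le_infty) _ _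
    have hc := hcl y hy
    rw [fderivWithin_of_mem_nhds (hnhds y hy h0), fderivWithin_of_mem_nhds (hnhds y hy h0)] at hc
    rw [(hw _ y hy h0).fderiv, (hw _ y hy h0).fderiv, fderivWithin_of_mem_nhds (hnhds y hy h0),
      fderivWithin_of_mem_nhds (hnhds y hy h0)]
    simp only [wedge, ContinuousLinearMap.comp_apply, add_apply,
      smul_apply, ContinuousLinearMap.prod_apply, fderivInnerCLM_apply,
      ContinuousLinearMap.flip_apply, innerSL_apply_apply, smul_eq_mul, hsymm, hc]
    ring
  · intro y hy
    have h0 : fderivWithin ℝ f T y = 0 := by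
      have he : f =ᶠ[𝓝[T] y] fun _ => 0 := by
        filter_upwards [inter_mem_nhdsWithin T (hK.isClosed.isOpen_compl.mem_nhds hy.2)] with z hz
        exact hfK z hz
      rw [he.fderivWithin_eq (hfK y hy)]; simp
    simp [h0, wedge]

/-! ### Differentials in charts, up to the boundary. -/

section Charts

variable {M : Type*} [TopologicalSpace M] [ChartedSpace (EuclideanHalfSpace 2) M]

/-- The preferred chart at a point of a surface with boundary. -/
abbrev chart (p : M) : PartialEquiv M Plane := extChartAt (𝓡∂ 2) p

variable {V : Type*} [NormedAddCommGroup V] [NormedSpace ℝ V]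

/-- The differential of a vector-valued map, in the coordinates of the preferred chart. -/
def diff (h : M → V) (q : M) : Plane →L[ℝ] V := mfderiv (𝓡∂ 2) 𝓘(ℝ, V) h q

/-- The differential of the inverse of the chart at `p`, at the image of the point `q`. -/
def chartInv (p q : M) : Plane →L[ℝ] Plane :=
  mfderivWithin 𝓘(ℝ, Plane) (𝓡∂ 2) (chart p).symm (range (𝓡∂ 2)) (chart p q)

lemma chart_target_eq (p : M) :
    (chart p).target = (𝓡∂ 2).symm ⁻¹' (chartAt (EuclideanHalfSpace 2) p).target ∩ range (𝓡∂ 2) :=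
  extChartAt_target (𝓡∂ 2) p

lemma isOpen_chart_target_aux (p : M) :
    IsOpen ((𝓡∂ 2).symm ⁻¹' (chartAt (EuclideanHalfSpace 2) p).target) :=
  (chartAt _ p).open_target.preimage (𝓡∂ 2).continuous_symm

lemma measurableSet_chart_target (p : M) : MeasurableSet (chart p).target := by
  rw [chart_target_eq]
  exact (isOpen_chart_target_aux p).measurableSet.inter (𝓡∂ 2).isClosed_range.measurableSet

lemma uniqueDiffOn_chart_target (p : M) : UniqueDiffOn ℝ (chart p).target := by
  rw [chart_target_eq, inter_comm]
  exact (𝓡∂ 2).uniqueDiffOn.inter (isOpen_chart_target_aux p)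

lemma chart_nonneg (p q : M) (hq : q ∈ (chart p).source) : 0 ≤ chart p q 0 := by
  have ht := (chart p).map_source hq
  rw [chart_target_eq, range_model] at ht
  exact ht.2

variable [IsManifold (𝓡∂ 2) ∞ M]

lemma hasFDerivWithinAt_comp_chart_symm {h : M → V} {p q : M} (hq : q ∈ (chart p).source)
    (hh : MDifferentiableAt (𝓡∂ 2) 𝓘(ℝ, V) h q) :
    HasFDerivWithinAt (h ∘ (chart p).symm) ((diff h q).comp (chartInv p q)) (range (𝓡∂ 2))
      (chart p q) := by
  have h1 : HasMFDerivWithinAt 𝓘(ℝ, Plane) (𝓡∂ 2) (chart p).symm (range (𝓡∂ 2)) (chart p q)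
      (chartInv p q) :=
    (mdifferentiableWithinAt_extChartAt_symm ((chart p).map_source hq)).hasMFDerivWithinAt
  have h2 : HasMFDerivAt (𝓡∂ 2) 𝓘(ℝ, V) h ((chart p).symm (chart p q))
      (diff h q : Plane →L[ℝ] V) := by
    rw [(chart p).left_inv hq]; exact hh.hasMFDerivAt
  have h3 : HasMFDerivWithinAt 𝓘(ℝ, Plane) 𝓘(ℝ, V) (h ∘ (chart p).symm) (range (𝓡∂ 2)) (chart p q)
      ((diff h q).comp (chartInv p q)) := h2.comp_hasMFDerivWithinAt _ h1
  exact hasMFDerivWithinAt_iff_hasFDerivWithinAt.1 h3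

lemma fderivWithin_comp_chart_symm {h : M → V} {p q : M} (hq : q ∈ (chart p).source)
    (hh : MDifferentiableAt (𝓡∂ 2) 𝓘(ℝ, V) h q) :
    fderivWithin ℝ (h ∘ (chart p).symm) (chart p).target (chart p q) =
      (diff h q).comp (chartInv p q) :=
  ((hasFDerivWithinAt_comp_chart_symm hq hh).mono (extChartAt_target_subset_range p)).fderivWithin
    (uniqueDiffOn_chart_target p _ ((chart p).map_source hq))

lemma contDiffOn_comp_chart_symm {h : M → V} (hh : ContMDiff (𝓡∂ 2) 𝓘(ℝ, V) ∞ h) (p : M) :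
    ContDiffOn ℝ ∞ (h ∘ (chart p).symm) (chart p).target :=
  (hh.comp_contMDiffOn (contMDiffOn_extChartAt_symm p)).contDiffOn

lemma diff_chart_comp_chartInv {p q : M} (hq : q ∈ (chart p).source) :
    (diff (chart p) q).comp (chartInv p q) = ContinuousLinearMap.id ℝ Plane :=
  mfderiv_extChartAt_comp_mfderivWithin_extChartAt_symm' (I := 𝓡∂ 2) hq

lemma chartInv_comp_diff_chart {p q : M} (hq : q ∈ (chart p).source) :
    (chartInv p q).comp (diff (chart p) q) = ContinuousLinearMap.id ℝ Plane :=
  mfderivWithin_extChartAt_symm_comp_mfderiv_extChartAt' (I := 𝓡∂ 2) hq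

/-- `mfderiv` at a point is computed in the preferred chart there, so this chart and its inverse
disappear. Pointwise identities thus reduce to ordinary derivatives within the half-plane. -/
lemma diff_chart_self (p : M) : diff (chart p) p = ContinuousLinearMap.id ℝ Plane :=
  mfderiv_extChartAt_self (I := 𝓡∂ 2)

lemma chartInv_self (p : M) : chartInv p p = ContinuousLinearMap.id ℝ Plane :=
  mfderivWithin_range_extChartAt_symm (I := 𝓡∂ 2)

lemma mdifferentiableAt_chart {p q : M} (hq : q ∈ (chart p).source) :
    MDifferentiableAt (𝓡∂ 2) 𝓘(ℝ, Plane) (chart p) q :=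
  mdifferentiableAt_extChartAt (by rwa [extChartAt_source] at hq)

lemma det_chartInv_ne_zero {p q : M} (hq : q ∈ (chart p).source) : (chartInv p q).det ≠ 0 := by
  intro h
  have := congrArg ContinuousLinearMap.det (diff_chart_comp_chartInv hq)
  rw [ContinuousLinearMap.det, ContinuousLinearMap.det, ContinuousLinearMap.toLinearMap_comp,
    LinearMap.det_comp] at this
  rw [ContinuousLinearMap.det] at h
  rw [h] at this
  simp at this

/-- Being an interior point does not depend on the chart of the smooth atlas, and the interior of a
chart target is its part in the open half-plane. -/
lemma mem_boundary_iff {p q : M} (hq : q ∈ (chart p).source) :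
    q ∈ (𝓡∂ 2).boundary M ↔ chart p q 0 = 0 := by
  have h1 := (𝓡∂ 2).isInteriorPoint_iff_of_mem_atlas (n := ∞) (M := M) (by simp)
    (chart_mem_atlas (EuclideanHalfSpace 2) p) (by rwa [extChartAt_source] at hq)
  have h2 : (𝓡∂ 2).IsInteriorPoint q ↔ chart p q ∈ interior (chart p).target := h1
  have ht := (chart p).map_source hq
  rw [chart_target_eq, interior_inter, (isOpen_chart_target_aux p).interior_eq,
    interior_range_model] at h2
  rw [chart_target_eq, range_model] at ht
  have h3 : q ∈ (𝓡∂ 2).boundary M ↔ ¬ (𝓡∂ 2).IsInteriorPoint q :=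
    (𝓡∂ 2).isBoundaryPoint_iff_not_isInteriorPoint q
  have h4 : 0 ≤ chart p q 0 := ht.2
  rw [h3, h2]
  constructor
  · intro h
    by_contra h0
    exact h ⟨ht.1, lt_of_le_of_ne h4 (Ne.symm h0)⟩
  · rintro h ⟨-, h0⟩
    exact h0.ne' h

/-- The first coordinate of any chart has, at a boundary point, a differential that is positive on
the inward coordinate vector of the preferred chart. -/
lemma diff_chart_inward_pos {p q : M} (hq : q ∈ (chart p).source) (hb : q ∈ (𝓡∂ 2).boundary M) :
    diff (chart p) q (stdVec 1) 0 = 0 ∧ 0 < diff (chart p) q (stdVec 0) 0 := by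
  have hqq := mem_extChartAt_source (I := 𝓡∂ 2) q
  have hz : chart q q 0 = 0 := (mem_boundary_iff hqq).1 hb
  have hz' : chart p q 0 = 0 := (mem_boundary_iff hq).1 hb
  have hd := hasFDerivWithinAt_comp_chart_symm hqq (mdifferentiableAt_chart hq)
  rw [chartInv_self, ContinuousLinearMap.comp_id] at hd
  have hd0 : HasFDerivWithinAt (fun y => ((chart p) ((chart q).symm y)) 0)
      ((EuclideanSpace.proj 0 : Plane →L[ℝ] ℝ).comp (diff (chart p) q))
      (range (𝓡∂ 2)) (chart q q) :=
    (EuclideanSpace.proj 0 : Plane →L[ℝ] ℝ).hasFDerivAt.comp_hasFDerivWithinAt _ hd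
  -- The first coordinate of the transition map is nonnegative and vanishes at the boundary point.
  -- Its differential is therefore nonnegative on inward vectors, hence zero on the boundary
  -- direction and its opposite; invertibility makes it positive on `stdVec 0`.
  have hmin : IsLocalMinOn (fun y => ((chart p) ((chart q).symm y)) 0) (range (𝓡∂ 2))
      (chart q q) := by
    have hc : ContinuousWithinAt (chart q).symm (range (𝓡∂ 2)) (chart q q) :=
      (continuousAt_extChartAt_symm q).continuousWithinAt
    have hn : (chart p).source ∈ 𝓝 ((chart q).symm (chart q q)) := by
      rw [(chart q).left_inv hqq]; exact (isOpen_extChartAt_source p).mem_nhds hq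
    filter_upwards [hc hn] with y hy
    rw [(chart q).left_inv hqq, hz']
    exact chart_nonneg p _ hy
  have hcone : ∀ v : Plane, 0 ≤ v 0 → 0 ≤ diff (chart p) q v 0 := by
    intro v hv
    have hseg : segment ℝ (chart q q) (chart q q + v) ⊆ range (𝓡∂ 2) := by
      refine (𝓡∂ 2).convex_range.segment_subset (extChartAt_target_subset_range q
        ((chart q).map_source hqq)) ?_
      rw [range_model]
      change 0 ≤ chart q q 0 + v 0
      rwa [hz, zero_add]
    simpa using hmin.hasFDerivWithinAt_nonneg hd0 (mem_posTangentConeAt_of_segment_subset hseg)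
  have h1 : diff (chart p) q (stdVec 1) 0 = 0 := by
    have := hcone (stdVec 1) (by simp)
    have h' := hcone (-stdVec 1) (by simp)
    rw [map_neg, PiLp.neg_apply] at h'
    linarith
  refine ⟨h1, lt_of_le_of_ne (hcone (stdVec 0) (by simp)) fun h0 => ?_⟩
  have hdet := congrArg ContinuousLinearMap.det (chartInv_comp_diff_chart hq)
  rw [ContinuousLinearMap.det, ContinuousLinearMap.det, ContinuousLinearMap.toLinearMap_comp,
    LinearMap.det_comp] at hdet
  have h2 := det_plane (diff (chart p) q)
  rw [h1, ← h0, ContinuousLinearMap.det] at h2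
  rw [h2] at hdet
  simp at hdet

end Charts

lemma _root_.ContinuousOn.areaForm {α : Type*} [TopologicalSpace α] {s : Set α}
    {L : α → Plane →L[ℝ] Space} {n : α → Space} (hL : ContinuousOn L s) (hn : ContinuousOn n s) :
    ContinuousOn (fun y => areaForm (L y) (n y)) s := by
  have h0 : ContinuousOn (fun y => L y (stdVec 0)) s := hL.clm_apply continuousOn_const
  have h1 : ContinuousOn (fun y => L y (stdVec 1)) s := hL.clm_apply continuousOn_const
  simp only [RotatingSurface.areaForm, inner_cross]
  fun_prop

lemma _root_.ContinuousOn.wedge {α : Type*} [TopologicalSpace α] {s : Set α}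
    {l m : α → Plane →L[ℝ] ℝ} (hl : ContinuousOn l s) (hm : ContinuousOn m s) :
    ContinuousOn (fun y => wedge (l y) (m y)) s :=
  ((hl.clm_apply continuousOn_const).mul (hm.clm_apply continuousOn_const)).sub
    ((hl.clm_apply continuousOn_const).mul (hm.clm_apply continuousOn_const))

/-! ### Integration against area, and Stokes' theorem in one chart. -/

section AreaIntegral

variable {M : Type*} [TopologicalSpace M] [ChartedSpace (EuclideanHalfSpace 2) M]

/-- The density of the area form in the chart at `p`, at the point `q`. -/
def chartArea (x N : M → Space) (p q : M) : ℝ :=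
  areaForm ((diff x q).comp (chartInv p q)) (N q)

/-- The integral with respect to area, over the domain of the chart at `p`. -/
def areaIntegral (x N : M → Space) (p : M) (u : M → ℝ) : ℝ :=
  ∫ y in (chart p).target, u ((chart p).symm y) * |chartArea x N p ((chart p).symm y)|

/-- The 1-form `⟨F, dx⟩`. -/
def oneForm (x F : M → Space) (q : M) : Plane →L[ℝ] ℝ := (innerSL ℝ (F q)).comp (diff x q)

/-- The quotient of the 2-form `df ∧ ⟨F, dx⟩` by the area form. -/
def wedgeDensity (x N F : M → Space) (f : M → ℝ) (q : M) : ℝ :=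
  wedge (diff f q) (oneForm x F q) / areaForm (diff x q) (N q)

lemma chartArea_eq (x N : M → Space) (p q : M) :
    chartArea x N p q = (chartInv p q).det * areaForm (diff x q) (N q) :=
  areaForm_comp _ _ _

lemma diff_eq_zero {V : Type*} [NormedAddCommGroup V] [NormedSpace ℝ V] {f : M → V} {q : M}
    (hq : q ∉ tsupport f) : diff f q = 0 := by
  have h : f =ᶠ[𝓝 q] fun _ => 0 := notMem_tsupport_iff_eventuallyEq.1 hq
  exact h.mfderiv_eq.trans (mfderiv_const (I := 𝓡∂ 2) (I' := 𝓘(ℝ, V)))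

lemma wedgeDensity_eq_zero (x N F : M → Space) {f : M → ℝ} {q : M} (hq : q ∉ tsupport f) :
    wedgeDensity x N F f q = 0 := by
  simp [wedgeDensity, diff_eq_zero hq, wedge]

variable {x N F : M → Space}

/-- Both 2-forms scale by the same determinant under a change of chart, so their quotient is a
function on the surface. -/
lemma wedgeDensity_mul_chartArea {f : M → ℝ} {p q : M} (ha : areaForm (diff x q) (N q) ≠ 0) :
    wedgeDensity x N F f q * chartArea x N p q =
      wedge ((diff f q).comp (chartInv p q)) ((oneForm x F q).comp (chartInv p q)) := by
  rw [wedge_comp, chartArea_eq, wedgeDensity]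
  field_simp

variable [IsManifold (𝓡∂ 2) ∞ M]

/-- Change of variables along the transition map, whose Jacobian is the ratio of the two area
densities. The absolute values make this independent of the orientations of the charts. -/
lemma areaIntegral_eq_of_support (p p' : M) (u : M → ℝ)
    (hu : ∀ q, u q ≠ 0 → q ∈ (chart p).source ∩ (chart p').source) :
    areaIntegral x N p u = areaIntegral x N p' u := by
  have hmeas : ∀ p p' : M, MeasurableSet ((chart p).target ∩ (chart p).symm ⁻¹' (chart p').source) := by
    intro p p'
    obtain ⟨U, hU, he⟩ := continuousOn_iff'.1 (continuousOn_extChartAt_symm (I := 𝓡∂ 2) p) _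
      (isOpen_extChartAt_source (I := 𝓡∂ 2) p')
    rw [inter_comm, he]
    exact hU.measurableSet.inter (measurableSet_chart_target p)
  have hres : ∀ p p' : M, (∀ q, u q ≠ 0 → q ∈ (chart p').source) → areaIntegral x N p u =
      ∫ y in (chart p).target ∩ (chart p).symm ⁻¹' (chart p').source,
        u ((chart p).symm y) * |chartArea x N p ((chart p).symm y)| := by
    intro p p' h
    refine (setIntegral_eq_of_subset_of_forall_sdiff_eq_zero (measurableSet_chart_target p)
      inter_subset_left fun y hy => ?_)
    have : u ((chart p).symm y) = 0 := by
      by_contra h0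
      exact hy.2 ⟨hy.1, h _ h0⟩
    rw [this, zero_mul]
  rw [hres p p' fun q hq => (hu q hq).2, hres p' p fun q hq => (hu q hq).1]
  have himg : (chart p').target ∩ (chart p').symm ⁻¹' (chart p).source =
      (chart p' ∘ (chart p).symm) '' ((chart p).target ∩ (chart p).symm ⁻¹' (chart p').source) := by
    ext z
    constructor
    · rintro ⟨hz, hz'⟩
      refine ⟨chart p ((chart p').symm z), ⟨(chart p).map_source hz', ?_⟩, ?_⟩
      · rw [mem_preimage, (chart p).left_inv hz']; exact (chart p').map_target hz
      · rw [Function.comp_apply, (chart p).left_inv hz', (chart p').right_inv hz]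
    · rintro ⟨y, ⟨hy, hy'⟩, rfl⟩
      refine ⟨(chart p').map_source hy', ?_⟩
      rw [mem_preimage, Function.comp_apply, (chart p').left_inv hy']
      exact (chart p).map_target hy
  have hinj : InjOn (chart p' ∘ (chart p).symm)
      ((chart p).target ∩ (chart p).symm ⁻¹' (chart p').source) := fun y hy z hz h =>
    (chart p).symm.injOn hy.1 hz.1 ((chart p').injOn hy.2 hz.2 h)
  have hder : ∀ y ∈ (chart p).target ∩ (chart p).symm ⁻¹' (chart p').source,
      HasFDerivWithinAt (chart p' ∘ (chart p).symm)
        ((diff (chart p') ((chart p).symm y)).comp (chartInv p ((chart p).symm y)))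
        ((chart p).target ∩ (chart p).symm ⁻¹' (chart p').source) y := by
    intro y hy
    have h := hasFDerivWithinAt_comp_chart_symm ((chart p).map_target hy.1)
      (mdifferentiableAt_chart hy.2)
    rw [(chart p).right_inv hy.1] at h
    exact h.mono (inter_subset_left.trans (extChartAt_target_subset_range p))
  rw [himg, integral_image_eq_integral_abs_det_fderiv_smul volume (hmeas p p') hder hinj]
  refine setIntegral_congr_fun (hmeas p p') fun y hy => ?_
  simp only [Function.comp_apply, smul_eq_mul]
  rw [(chart p').left_inv hy.2, mul_left_comm, ← abs_mul]
  congr 2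
  -- By the chain rule, the inverse of the second chart composed with the transition map has the
  -- differential of the inverse of the first chart.
  rw [chartArea, chartArea, ← areaForm_comp, ContinuousLinearMap.comp_assoc,
    ← ContinuousLinearMap.comp_assoc (chartInv p' _), chartInv_comp_diff_chart hy.2,
    ContinuousLinearMap.id_comp]

/-- `diff h q` alone refers to the preferred chart at `q`, which may jump with `q`. Composed with
`chartInv` it is the derivative of `h` in one fixed chart, which is continuous. -/
lemma continuousOn_diff_comp_chartInv {V : Type*} [NormedAddCommGroup V] [NormedSpace ℝ V]
    {h : M → V} (hh : ContMDiff (𝓡∂ 2) 𝓘(ℝ, V) ∞ h) (p : M) :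
    ContinuousOn (fun y => (diff h ((chart p).symm y)).comp (chartInv p ((chart p).symm y)))
      (chart p).target := by
  refine ((contDiffOn_comp_chart_symm hh p).continuousOn_fderivWithin
    (uniqueDiffOn_chart_target p) (by simp)).congr fun y hy => ?_
  have h1 := fderivWithin_comp_chart_symm ((chart p).map_target hy)
    ((hh.mdifferentiable (by simp)) ((chart p).symm y))
  rw [(chart p).right_inv hy] at h1
  exact h1.symm

lemma continuousOn_chartArea (hx : ContMDiff (𝓡∂ 2) 𝓘(ℝ, Space) ∞ x) (hN : Continuous N) (p : M) :
    ContinuousOn (fun y => chartArea x N p ((chart p).symm y)) (chart p).target := by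
  exact (continuousOn_diff_comp_chartInv hx p).areaForm
    (hN.comp_continuousOn (continuousOn_extChartAt_symm p))

lemma integrableOn_chart (hx : ContMDiff (𝓡∂ 2) 𝓘(ℝ, Space) ∞ x) (hN : Continuous N) (p : M) {u : M → ℝ} {K : Set M} (hK : IsCompact K)
    (hKp : K ⊆ (chart p).source) (hu : ContinuousOn (u ∘ (chart p).symm) (chart p).target)
    (hu0 : ∀ q ∉ K, u q = 0) :
    IntegrableOn (fun y => u ((chart p).symm y) * |chartArea x N p ((chart p).symm y)|)
      (chart p).target := by
  have hKc : IsCompact (chart p '' K) :=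
    hK.image_of_continuousOn ((continuousOn_extChartAt p).mono hKp)
  have hsub : chart p '' K ⊆ (chart p).target := by
    rintro _ ⟨q, hq, rfl⟩; exact (chart p).map_source (hKp hq)
  have hc : ContinuousOn (fun y => u ((chart p).symm y) * |chartArea x N p ((chart p).symm y)|)
      (chart p).target := hu.mul (continuousOn_chartArea hx hN p).abs
  refine ((hc.mono hsub).integrableOn_compact hKc).of_forall_sdiff_eq_zero
    (measurableSet_chart_target p) fun y hy => ?_
  rw [hu0, zero_mul]
  exact fun h => hy.2 ⟨_, h, (chart p).right_inv hy.1⟩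

lemma continuousOn_wedgeDensity (hx : ContMDiff (𝓡∂ 2) 𝓘(ℝ, Space) ∞ x) (hN : Continuous N) (hF : Continuous F)
    (ha : ∀ q, areaForm (diff x q) (N q) ≠ 0) {f : M → ℝ} (hf : ContMDiff (𝓡∂ 2) 𝓘(ℝ, ℝ) ∞ f)
    (p : M) : ContinuousOn (wedgeDensity x N F f ∘ (chart p).symm) (chart p).target := by
  have hne : ∀ y ∈ (chart p).target, chartArea x N p ((chart p).symm y) ≠ 0 := by
    intro y hy
    rw [chartArea_eq]
    exact mul_ne_zero (det_chartInv_ne_zero ((chart p).map_target hy)) (ha _)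
  have hdf := continuousOn_diff_comp_chartInv hf p
  have hdx := continuousOn_diff_comp_chartInv hx p
  have hFc : ContinuousOn (fun y => F ((chart p).symm y)) (chart p).target :=
    hF.comp_continuousOn (continuousOn_extChartAt_symm p)
  have hi : ContinuousOn (fun y => (innerSL ℝ (F ((chart p).symm y))).comp
      ((diff x ((chart p).symm y)).comp (chartInv p ((chart p).symm y)))) (chart p).target :=
    ((innerSL ℝ).continuous.comp_continuousOn hFc).clm_comp hdx
  -- The quotient is rewritten in the fixed chart at `p`, where numerator and denominator are
  -- separately continuous.
  refine ((hdf.wedge hi).div (continuousOn_chartArea hx hN p) hne).congr fun y hy => ?_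
  exact eq_div_of_mul_eq (hne y hy) (wedgeDensity_mul_chartArea (ha _))

/-- Stokes' theorem in a chart, on a set where the area form of the chart has a constant sign. -/
lemma areaIntegral_wedgeDensity [CompactSpace M] (hx : ContMDiff (𝓡∂ 2) 𝓘(ℝ, Space) ∞ x) (hF : ContMDiff (𝓡∂ 2) 𝓘(ℝ, Space) ∞ F)
    (ha : ∀ q, areaForm (diff x q) (N q) ≠ 0)
    (hcl : ∀ q, (inner ℝ (diff F q (stdVec 0)) (diff x q (stdVec 1)) : ℝ) =
      inner ℝ (diff F q (stdVec 1)) (diff x q (stdVec 0)))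
    {f : M → ℝ} (hf : ContMDiff (𝓡∂ 2) 𝓘(ℝ, ℝ) ∞ f) {p : M} {σ : ℝ} (hσ : |σ| = 1)
    (hfp : ∀ q ∈ tsupport f, q ∈ (chart p).source ∧ 0 < σ * chartArea x N p q) :
    areaIntegral x N p (wedgeDensity x N F f) =
      -σ * ∫ t in {t : ℝ | mkPlane (0, t) ∈ (chart p).target},
        f ((chart p).symm (mkPlane (0, t))) *
          oneForm x F ((chart p).symm (mkPlane (0, t)))
            (chartInv p ((chart p).symm (mkPlane (0, t))) (stdVec 1)) := by
  have hfd : ∀ {V : Type} [NormedAddCommGroup V] [NormedSpace ℝ V] {h : M → V},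
      ContMDiff (𝓡∂ 2) 𝓘(ℝ, V) ∞ h → ∀ y ∈ (chart p).target,
      fderivWithin ℝ (h ∘ (chart p).symm) (chart p).target y =
        (diff h ((chart p).symm y)).comp (chartInv p ((chart p).symm y)) := by
    intro V _ _ h hh y hy
    have h1 := fderivWithin_comp_chart_symm ((chart p).map_target hy)
      ((hh.mdifferentiable (by simp)) ((chart p).symm y))
    rwa [(chart p).right_inv hy] at h1
  have hKp : tsupport f ⊆ (chart p).source := fun q hq => (hfp q hq).1
  have hK : IsCompact (chart p '' tsupport f) :=
    (isClosed_tsupport f).isCompact.image_of_continuousOn ((continuousOn_extChartAt p).mono hKp)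
  have hKT : chart p '' tsupport f ⊆ (chart p).target := by
    rintro _ ⟨q, hq, rfl⟩; exact (chart p).map_source (hKp hq)
  have key := stokes_closed_form (isOpen_chart_target_aux p) (chart_target_eq p)
    (uniqueDiffOn_chart_target p) hK hKT (contDiffOn_comp_chart_symm hf p)
    (contDiffOn_comp_chart_symm hF p) (contDiffOn_comp_chart_symm hx p) ?_ ?_
  · have hm : MeasurableSet {t : ℝ | mkPlane (0, t) ∈ (chart p).target} :=
      (by fun_prop : Continuous fun t : ℝ => mkPlane (0, t)).measurable
        (measurableSet_chart_target p)
    have e1 : ∫ t in {t : ℝ | mkPlane (0, t) ∈ (chart p).target},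
        f ((chart p).symm (mkPlane (0, t))) *
          oneForm x F ((chart p).symm (mkPlane (0, t)))
            (chartInv p ((chart p).symm (mkPlane (0, t))) (stdVec 1)) =
        ∫ t in {t : ℝ | mkPlane (0, t) ∈ (chart p).target},
          (f ∘ (chart p).symm) (mkPlane (0, t)) * inner ℝ ((F ∘ (chart p).symm) (mkPlane (0, t)))
            (fderivWithin ℝ (x ∘ (chart p).symm) (chart p).target (mkPlane (0, t)) (stdVec 1)) := by
      refine setIntegral_congr_fun hm fun t ht => ?_
      rw [hfd hx _ ht]; rfl
    rw [e1, neg_mul, ← mul_neg, ← key, areaIntegral, ← integral_const_mul]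
    refine setIntegral_congr_fun (measurableSet_chart_target p) fun y hy => ?_
    simp only
    rw [hfd hx y hy, hfd hf y hy]
    by_cases hq : (chart p).symm y ∈ tsupport f
    -- Area is unsigned and the 2-form is signed; on the support of `f` they differ by the constant
    -- sign `σ`.
    · have habs : |chartArea x N p ((chart p).symm y)| = σ * chartArea x N p ((chart p).symm y) := by
        rw [← abs_of_pos (hfp _ hq).2, abs_mul, hσ, one_mul]
      rw [habs, mul_left_comm, wedgeDensity_mul_chartArea (ha _)]
      rfl
    · rw [wedgeDensity_eq_zero _ _ _ hq, diff_eq_zero hq]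
      simp [wedge]
  · intro y hy
    by_contra h0
    exact hy.2 ⟨_, subset_tsupport f h0, (chart p).right_inv hy.1⟩
  · intro y hy
    rw [hfd hF y hy, hfd hx y hy]
    -- Closedness is the vanishing of an alternating bilinear form, so it passes from the preferred
    -- basis to its image under `A`.
    set A := chartInv p ((chart p).symm y)
    have hc := hcl ((chart p).symm y)
    simp only [ContinuousLinearMap.comp_apply]
    rw [map_plane (diff F _) (A (stdVec 0)), map_plane (diff F _) (A (stdVec 1)),
      map_plane (diff x _) (A (stdVec 0)), map_plane (diff x _) (A (stdVec 1))]
    simp only [inner_add_left, inner_add_right, real_inner_smul_left, real_inner_smul_right, hc]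
    ring

end AreaIntegral

/-! ### The boundary curves in charts. -/

namespace BoundaryParametrization

variable {M : Type*} [TopologicalSpace M] [ChartedSpace (EuclideanHalfSpace 2) M]
  {x N : M → Space} (P : BoundaryParametrization x N)

/-- The velocity of a boundary curve, in the coordinates of the preferred chart. -/
def velocity (k : Fin P.n) (s : ℝ) : Plane :=
  mfderiv 𝓘(ℝ, ℝ) (𝓡∂ 2) (P.γ k) s (1 : ℝ)

lemma continuous_γ (k : Fin P.n) : Continuous (P.γ k) := (P.smooth k).continuous

lemma γ_mem_boundary (k : Fin P.n) (s : ℝ) : P.γ k s ∈ (𝓡∂ 2).boundary M := by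
  obtain ⟨t, ht, hst⟩ := (P.periodic k).exists_mem_Ico₀ (P.ℓ_pos k) s
  rw [hst]
  have h : (k, t) ∈ {q : Fin P.n × ℝ | q.2 ∈ Ico 0 (P.ℓ q.1)} := ht
  have h' := P.bijOn.mapsTo h
  exact h'

lemma hasDerivAt_comp_γ {V : Type*} [NormedAddCommGroup V] [NormedSpace ℝ V] {h : M → V}
    (k : Fin P.n) (s : ℝ) (hh : MDifferentiableAt (𝓡∂ 2) 𝓘(ℝ, V) h (P.γ k s)) :
    HasDerivAt (fun t => h (P.γ k t)) (diff h (P.γ k s) (P.velocity k s)) s := by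
  have h1 := ((P.smooth k).mdifferentiable (by simp) s).hasMFDerivAt
  have h2 : HasMFDerivAt 𝓘(ℝ, ℝ) 𝓘(ℝ, V) (h ∘ P.γ k) s
      ((diff h (P.γ k s)).comp (mfderiv 𝓘(ℝ, ℝ) (𝓡∂ 2) (P.γ k) s : ℝ →L[ℝ] Plane)) :=
    hh.hasMFDerivAt.comp s h1
  have h3 : HasFDerivAt (h ∘ P.γ k)
      ((diff h (P.γ k s)).comp (mfderiv 𝓘(ℝ, ℝ) (𝓡∂ 2) (P.γ k) s : ℝ →L[ℝ] Plane)) s :=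
    hasMFDerivAt_iff_hasFDerivAt.1 h2
  exact h3.hasDerivAt

lemma α'_eq (hx : ContMDiff (𝓡∂ 2) 𝓘(ℝ, Space) ∞ x) (k : Fin P.n) (s : ℝ) :
    P.α' k s = diff x (P.γ k s) (P.velocity k s) :=
  (P.hasDerivAt_comp_γ k s (hx.mdifferentiable (by simp) _)).deriv

variable [IsManifold (𝓡∂ 2) ∞ M]

/-- The curve stays in the boundary, so its first chart coordinate is locally constant zero. -/
lemma diff_chart_velocity_zero {p : M} (k : Fin P.n) (s : ℝ) (hq : P.γ k s ∈ (chart p).source) :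
    diff (chart p) (P.γ k s) (P.velocity k s) 0 = 0 := by
  have h1 := P.hasDerivAt_comp_γ k s (mdifferentiableAt_chart hq)
  have h2 : HasDerivAt (fun t => chart p (P.γ k t) 0)
      (diff (chart p) (P.γ k s) (P.velocity k s) 0) s :=
    (EuclideanSpace.proj 0 : Plane →L[ℝ] ℝ).hasFDerivAt.comp_hasDerivAt s h1
  have h3 : (fun t => chart p (P.γ k t) 0) =ᶠ[𝓝 s] fun _ => 0 := by
    filter_upwards [(P.continuous_γ k).continuousAt.preimage_mem_nhds
      ((isOpen_extChartAt_source p).mem_nhds hq)] with t ht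
    exact (mem_boundary_iff ht).1 (P.γ_mem_boundary k t)
  exact h2.unique ((hasDerivAt_const s (0 : ℝ)).congr_of_eventuallyEq h3)

lemma velocity_eq (k : Fin P.n) (s : ℝ) :
    P.velocity k s = P.velocity k s 1 • stdVec 1 := by
  have h := P.diff_chart_velocity_zero k s (mem_extChartAt_source (I := 𝓡∂ 2) (P.γ k s))
  rw [diff_chart_self, ContinuousLinearMap.id_apply] at h
  conv_lhs => rw [plane_eq (P.velocity k s), h, zero_smul, zero_add]

/-- The half-plane lies to the right of its boundary line, so the induced orientation points
downwards in a positive chart; hence the negative sign. -/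
lemma velocity_orientation (hx : ContMDiff (𝓡∂ 2) 𝓘(ℝ, Space) ∞ x) (k : Fin P.n) (s : ℝ) :
    P.velocity k s 1 * areaForm (diff x (P.γ k s)) (N (P.γ k s)) < 0 := by
  have ho := P.oriented k s
  have h1 : deriv (fun t => x (P.γ k t)) s =
      P.velocity k s 1 • diff x (P.γ k s) (stdVec 1) := by
    rw [← map_smul, ← velocity_eq]; exact P.α'_eq hx k s
  have h2 : ∃ c μ : ℝ, 0 ≤ c ∧ inwardConormal x (P.γ k s) =
      c • (diff x (P.γ k s) (stdVec 0) - μ • diff x (P.γ k s) (stdVec 1)) :=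
    ⟨_, _, inv_nonneg.2 (norm_nonneg _), rfl⟩
  obtain ⟨c, μ, hc, h2⟩ := h2
  rw [h1, h2] at ho
  have h3 : inner ℝ (cross (-(c • (diff x (P.γ k s) (stdVec 0) - μ • diff x (P.γ k s) (stdVec 1))))
      (P.velocity k s 1 • diff x (P.γ k s) (stdVec 1))) (N (P.γ k s)) =
      -c * (P.velocity k s 1 * areaForm (diff x (P.γ k s)) (N (P.γ k s))) := by
    simp only [areaForm, inner_cross, PiLp.neg_apply, PiLp.smul_apply, PiLp.sub_apply, smul_eq_mul]
    ring
  rw [h3] at ho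
  by_contra! h4
  nlinarith [mul_nonneg hc h4]

/-- In any chart, the boundary curves run along the boundary of the half-plane, upwards or downwards
according to the orientation of the chart. -/
lemma exists_hasDerivAt_chart (hx : ContMDiff (𝓡∂ 2) 𝓘(ℝ, Space) ∞ x) {p : M} (k : Fin P.n) (s : ℝ)
    (hq : P.γ k s ∈ (chart p).source) :
    ∃ c : ℝ, HasDerivAt (fun t => chart p (P.γ k t) 1) c s ∧
      P.α' k s = c • diff x (P.γ k s) (chartInv p (P.γ k s) (stdVec 1)) ∧
      c * chartArea x N p (P.γ k s) < 0 := by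
  have h0 := P.diff_chart_velocity_zero k s hq
  obtain ⟨hb, hb'⟩ := diff_chart_inward_pos hq (P.γ_mem_boundary k s)
  have ho := P.velocity_orientation hx k s
  have hAB := chartInv_comp_diff_chart hq
  refine ⟨diff (chart p) (P.γ k s) (P.velocity k s) 1, ?_, ?_, ?_⟩
  · exact (EuclideanSpace.proj 1 : Plane →L[ℝ] ℝ).hasFDerivAt.comp_hasDerivAt s
      (P.hasDerivAt_comp_γ k s (mdifferentiableAt_chart hq))
  · have h1 : P.velocity k s = chartInv p (P.γ k s) (diff (chart p) (P.γ k s) (P.velocity k s)) := by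
      rw [← ContinuousLinearMap.comp_apply, hAB, ContinuousLinearMap.id_apply]
    rw [P.α'_eq hx, ← map_smul, ← map_smul]
    conv_lhs => rw [h1, plane_eq (diff (chart p) (P.γ k s) (P.velocity k s)), h0, zero_smul,
      zero_add]
  · have h2 : diff (chart p) (P.γ k s) (P.velocity k s) 1 =
        P.velocity k s 1 * diff (chart p) (P.γ k s) (stdVec 1) 1 := by
      conv_lhs => rw [P.velocity_eq, map_smul]
      simp
    -- At a boundary point the differential of the chart is triangular with positive first diagonal
    -- entry, so its second diagonal entry has the sign of the determinant of `chartInv`.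
    have hdet := congrArg ContinuousLinearMap.det hAB
    rw [ContinuousLinearMap.det, ContinuousLinearMap.det, ContinuousLinearMap.toLinearMap_comp,
      LinearMap.det_comp] at hdet
    have h3 := det_plane (diff (chart p) (P.γ k s))
    rw [hb, zero_mul, sub_zero, ContinuousLinearMap.det] at h3
    rw [h3] at hdet
    have hdet' : (chartInv p (P.γ k s)).det * (diff (chart p) (P.γ k s) (stdVec 0) 0 *
        diff (chart p) (P.γ k s) (stdVec 1) 1) = 1 := by
      rw [ContinuousLinearMap.det, hdet]; simp
    rw [h2, chartArea_eq]
    have h5 : 0 < diff (chart p) (P.γ k s) (stdVec 1) 1 * (chartInv p (P.γ k s)).det := by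
      by_contra! h
      nlinarith [mul_nonneg hb'.le (neg_nonneg.2 h)]
    nlinarith [mul_pos h5 (neg_pos.2 ho)]

/-- The integral of `f ⟨F, dx⟩` over the part of the boundary in a chart, in the coordinate of the
chart. -/
lemma integral_eq_chart_integral [CompactSpace M] (hx : ContMDiff (𝓡∂ 2) 𝓘(ℝ, Space) ∞ x)
    {F : M → Space} (hF : Continuous F) {f : M → ℝ} (hf : Continuous f) {p : M} {σ : ℝ}
    (hσ : |σ| = 1) (hfp : ∀ q ∈ tsupport f, q ∈ (chart p).source ∧ 0 < σ * chartArea x N p q) :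
    P.integral (fun k s => f (P.γ k s) * inner ℝ (F (P.γ k s)) (P.α' k s)) =
      -σ * ∫ t in {t : ℝ | mkPlane (0, t) ∈ (chart p).target},
        f ((chart p).symm (mkPlane (0, t))) *
          oneForm x F ((chart p).symm (mkPlane (0, t)))
            (chartInv p ((chart p).symm (mkPlane (0, t))) (stdVec 1)) := by
  set u : ℝ → ℝ := fun t => f ((chart p).symm (mkPlane (0, t))) *
    oneForm x F ((chart p).symm (mkPlane (0, t)))
      (chartInv p ((chart p).symm (mkPlane (0, t))) (stdVec 1)) with hu
  set T₀ : Set ℝ := {t : ℝ | mkPlane (0, t) ∈ (chart p).target} with hT₀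
  have hmk : Continuous fun t : ℝ => mkPlane (0, t) := by fun_prop
  have hT₀m : MeasurableSet T₀ := hmk.measurable (measurableSet_chart_target p)
  let S : Fin P.n → Set ℝ := fun k => Ico 0 (P.ℓ k) ∩ P.γ k ⁻¹' (chart p).source
  let c : Fin P.n → ℝ → ℝ := fun k s => chart p (P.γ k s) 1
  have hS : ∀ k, MeasurableSet (S k) := fun k =>
    measurableSet_Ico.inter ((isOpen_extChartAt_source p).preimage (P.continuous_γ k)).measurableSet
  have hcs : ∀ k s, P.γ k s ∈ (chart p).source → mkPlane (0, c k s) = chart p (P.γ k s) := by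
    intro k s hs
    rw [← mkPlane_coord (chart p (P.γ k s)), (mem_boundary_iff hs).1 (P.γ_mem_boundary k s)]
  have hinj' : ∀ k k' s s', s ∈ S k → s' ∈ S k' → c k s = c k' s' → (k, s) = (k', s') := by
    intro k k' s s' hs hs' h
    refine P.bijOn.injOn hs.1 hs'.1 ((chart p).injOn hs.2 hs'.2 ?_)
    change chart p (P.γ k s) = chart p (P.γ k' s')
    rw [← hcs k s hs.2, ← hcs k' s' hs'.2, h]
  have hinj : ∀ k, InjOn (c k) (S k) := fun k s hs s' hs' h =>
    (Prod.ext_iff.1 (hinj' k k s s' hs hs' h)).2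
  -- Since the curves cover the boundary exactly once, their pieces inside the chart partition its
  -- boundary line.
  have hunion : T₀ = ⋃ k, c k '' S k := by
    ext t
    simp only [hT₀, mem_ofPred_eq, mem_iUnion, mem_image]
    constructor
    · intro ht
      have hq := (chart p).map_target ht
      have hb : (chart p).symm (mkPlane (0, t)) ∈ (𝓡∂ 2).boundary M := by
        rw [mem_boundary_iff hq, (chart p).right_inv ht, mkPlane_zero]
      obtain ⟨⟨k, s⟩, hs, hks⟩ := P.bijOn.surjOn hb
      have hks' : P.γ k s = (chart p).symm (mkPlane (0, t)) := hks
      refine ⟨k, s, ⟨hs, ?_⟩, ?_⟩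
      · rw [mem_preimage, hks']; exact hq
      · simp only [c]
        rw [hks', (chart p).right_inv ht, mkPlane_one]
    · rintro ⟨k, s, hs, rfl⟩
      rw [hcs k s hs.2]; exact (chart p).map_source hs.2
  have hder : ∀ k, ∀ s ∈ S k, ∃ d : ℝ, HasDerivAt (c k) d s ∧
      P.α' k s = d • diff x (P.γ k s) (chartInv p (P.γ k s) (stdVec 1)) ∧
      d * chartArea x N p (P.γ k s) < 0 := fun k s hs => P.exists_hasDerivAt_chart hx k s hs.2
  choose! d hd hd' hd'' using hder
  have hmeas : ∀ k, MeasurableSet (c k '' S k) := fun k =>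
    (hS k).image_of_continuousOn_injOn
      (fun s hs => (hd k s hs).continuousAt.continuousWithinAt) (hinj k)
  have hdisj : Pairwise (Function.onFun Disjoint fun k => c k '' S k) := by
    intro k k' hkk
    rw [Function.onFun, Set.disjoint_left]
    rintro _ ⟨s, hs, rfl⟩ ⟨s', hs', h⟩
    exact hkk (Prod.ext_iff.1 (hinj' k k' s s' hs hs' h.symm)).1
  have hint : IntegrableOn u T₀ := by
    have huc : ContinuousOn u T₀ := by
      have hi : ContinuousOn (fun y => inner ℝ (F ((chart p).symm y))
          (((diff x ((chart p).symm y)).comp (chartInv p ((chart p).symm y))) (stdVec 1)))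
          (chart p).target :=
        (hF.comp_continuousOn (continuousOn_extChartAt_symm p)).inner
          ((continuousOn_diff_comp_chartInv hx p).clm_apply continuousOn_const)
      exact ((hf.comp_continuousOn (continuousOn_extChartAt_symm p)).mul hi).comp
        hmk.continuousOn fun t ht => ht
    have hKp : tsupport f ⊆ (chart p).source := fun q hq => (hfp q hq).1
    have hK : IsCompact ((fun y : Plane => y 1) '' (chart p '' tsupport f ∩ {y | y 0 = 0})) := by
      refine IsCompact.image (IsCompact.inter_right ?_ ?_) (by fun_prop)
      · exact (isClosed_tsupport f).isCompact.image_of_continuousOn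
          ((continuousOn_extChartAt p).mono hKp)
      · exact isClosed_eq (by fun_prop) continuous_const
    have hKT : (fun y : Plane => y 1) '' (chart p '' tsupport f ∩ {y | y 0 = 0}) ⊆ T₀ := by
      rintro _ ⟨y, ⟨⟨q, hq, rfl⟩, h0⟩, rfl⟩
      have h0' : chart p q 0 = 0 := h0
      have := mkPlane_coord (chart p q)
      rw [h0'] at this
      simp only [hT₀, mem_ofPred_eq]
      rw [this]
      exact (chart p).map_source (hKp hq)
    refine ((huc.mono hKT).integrableOn_compact hK).of_forall_sdiff_eq_zero hT₀m fun t ht => ?_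
    simp only [hu]
    rw [mul_eq_zero]
    left
    by_contra h0
    refine ht.2 ⟨mkPlane (0, t), ⟨⟨_, subset_tsupport f h0, (chart p).right_inv ht.1⟩, ?_⟩, ?_⟩
    · exact mkPlane_zero _
    · exact mkPlane_one _
  have hσ2 : σ * σ = 1 := by rw [← abs_mul_abs_self, hσ, one_mul]
  have hpiece : ∀ k, ∫ s in (0 : ℝ)..P.ℓ k, f (P.γ k s) * inner ℝ (F (P.γ k s)) (P.α' k s) =
      -σ * ∫ t in c k '' S k, u t := by
    intro k
    rw [integral_image_eq_integral_abs_deriv_smul (hS k)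
      (fun s hs => (hd k s hs).hasDerivWithinAt) (hinj k), ← integral_const_mul,
      intervalIntegral.integral_of_le (P.ℓ_pos k).le, ← integral_Ico_eq_integral_Ioc,
      setIntegral_eq_of_subset_of_forall_sdiff_eq_zero measurableSet_Ico (inter_subset_left) ?_]
    · refine setIntegral_congr_fun (hS k) fun s hs => ?_
      simp only [hu, smul_eq_mul]
      rw [hcs k s hs.2, (chart p).left_inv hs.2, hd' k s hs]
      by_cases hq : P.γ k s ∈ tsupport f
      · have h1 := (hfp _ hq).2
        have h2 := hd'' k s hs
        -- On the support of `f`, `chartArea` has the sign of `σ` and `d` the opposite sign.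
        have habs : |d k s| = -σ * d k s := by
          have h3 : 0 < -σ * d k s := by
            by_contra! h4
            nlinarith [mul_nonneg h1.le (neg_nonneg.2 h4)]
          rw [← abs_of_pos h3, abs_mul, abs_neg, hσ, one_mul]
        rw [habs, real_inner_smul_right]
        simp only [oneForm, ContinuousLinearMap.comp_apply, innerSL_apply_apply]
        linear_combination (-(f (P.γ k s) * (d k s * inner ℝ (F (P.γ k s))
          (diff x (P.γ k s) (chartInv p (P.γ k s) (stdVec 1)))))) * hσ2
      · rw [image_eq_zero_of_notMem_tsupport hq]; simp
    · rintro s ⟨hs, hs'⟩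
      have : P.γ k s ∉ tsupport f := fun h => hs' ⟨hs, (hfp _ h).1⟩
      rw [image_eq_zero_of_notMem_tsupport this, zero_mul]
  rw [integral, Finset.sum_congr rfl fun k _ => hpiece k, ← Finset.mul_sum, hunion,
    integral_iUnion_fintype hmeas hdisj fun k => hint.mono_set ?_]
  rw [hunion]; exact subset_iUnion (fun k => c k '' S k) k

end BoundaryParametrization

/-! ### Stokes' theorem on the surface. -/

section Global

variable {M : Type*} [TopologicalSpace M] [ChartedSpace (EuclideanHalfSpace 2) M]

lemma areaIntegral_sum {ι : Type*} [Fintype ι] (x N : M → Space) (p : M) (u : ι → M → ℝ)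
    (hu : ∀ i, IntegrableOn (fun y => u i ((chart p).symm y) * |chartArea x N p ((chart p).symm y)|)
      (chart p).target) :
    areaIntegral x N p (fun q => ∑ i, u i q) = ∑ i, areaIntegral x N p (u i) := by
  simp only [areaIntegral, Finset.sum_mul]
  exact integral_finsetSum _ fun i _ => hu i

lemma BoundaryParametrization.continuous_α' {x N : M → Space} (P : BoundaryParametrization x N)
    (hx : ContMDiff (𝓡∂ 2) 𝓘(ℝ, Space) ∞ x) (k : Fin P.n) : Continuous (P.α' k) := by
  have h : ContDiff ℝ ∞ (P.α k) := (hx.comp (P.smooth k)).contDiff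
  exact h.continuous_deriv (by simp)

lemma BoundaryParametrization.integral_sum {x N : M → Space} (P : BoundaryParametrization x N)
    {ι : Type*} [Fintype ι] (u : ι → Fin P.n → ℝ → ℝ) (hu : ∀ i k, Continuous (u i k)) :
    P.integral (fun k s => ∑ i, u i k s) = ∑ i, P.integral (u i) := by
  simp only [BoundaryParametrization.integral]
  rw [Finset.sum_comm]
  refine Finset.sum_congr rfl fun k _ => ?_
  exact intervalIntegral.integral_finsetSum fun i _ => (hu i k).intervalIntegrable _ _

variable [IsManifold (𝓡∂ 2) ∞ M]

lemma isOpen_chartArea_pos {x N : M → Space} (hx : ContMDiff (𝓡∂ 2) 𝓘(ℝ, Space) ∞ x)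
    (hN : Continuous N) (p : M) (σ : ℝ) :
    IsOpen {q | q ∈ (chart p).source ∧ 0 < σ * chartArea x N p q} := by
  have h : ContinuousOn (fun q => σ * chartArea x N p q) (chart p).source := by
    refine continuousOn_const.mul ?_
    refine ((continuousOn_chartArea hx hN p).comp (continuousOn_extChartAt p)
      (chart p).mapsTo).congr fun q hq => ?_
    rw [Function.comp_apply, (chart p).left_inv hq]
  exact h.isOpen_inter_preimage (isOpen_extChartAt_source p) isOpen_Ioi

/-- The derivative of the constant 1, taken in the preferred chart. For a partition of unity this
cancels the interior terms in Stokes' theorem. -/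
lemma sum_diff_eq_zero {ι : Type*} [Fintype ι] {f : ι → M → ℝ}
    (hf : ∀ i, ContMDiff (𝓡∂ 2) 𝓘(ℝ, ℝ) ∞ (f i)) (h1 : ∀ q, ∑ i, f i q = 1) (q : M) :
    ∑ i, diff (f i) q = 0 := by
  have hq := mem_extChartAt_source (I := 𝓡∂ 2) q
  have h : HasFDerivWithinAt (fun y => ∑ i, f i ((chart q).symm y))
      (∑ i, diff (f i) q) (range (𝓡∂ 2)) (chart q q) := by
    refine HasFDerivWithinAt.fun_sum fun i _ => ?_
    have := hasFDerivWithinAt_comp_chart_symm hq ((hf i).mdifferentiable (by simp) q)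
    rwa [chartInv_self, ContinuousLinearMap.comp_id] at this
  simp only [h1] at h
  exact ((𝓡∂ 2).uniqueDiffOn _ (mem_range_self _)).eq h (hasFDerivWithinAt_const _ _ _)

/-- Stokes' theorem for the closed 1-form `⟨F, dx⟩` on a compact oriented surface with boundary. -/
theorem BoundaryParametrization.integral_closed_oneForm [T2Space M] [CompactSpace M]
    {x N F : M → Space} (P : BoundaryParametrization x N)
    (hx : ContMDiff (𝓡∂ 2) 𝓘(ℝ, Space) ∞ x) (hN : Continuous N)
    (hF : ContMDiff (𝓡∂ 2) 𝓘(ℝ, Space) ∞ F) (ha : ∀ q, areaForm (diff x q) (N q) ≠ 0)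
    (hcl : ∀ q, (inner ℝ (diff F q (stdVec 0)) (diff x q (stdVec 1)) : ℝ) =
      inner ℝ (diff F q (stdVec 1)) (diff x q (stdVec 0))) :
    P.integral (fun k s => inner ℝ (F (P.γ k s)) (P.α' k s)) = 0 := by
  -- The orientation is given by `N`, and the charts need not respect it. Each chart gets a sign,
  -- valid on a neighbourhood `U p` of its centre.
  have hσ : ∀ p, ∃ σ : ℝ, |σ| = 1 ∧ 0 < σ * chartArea x N p p := by
    intro p
    have hne : chartArea x N p p ≠ 0 := by
      rw [chartArea_eq]
      exact mul_ne_zero (det_chartInv_ne_zero (mem_extChartAt_source p)) (ha p)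
    rcases lt_or_gt_of_ne hne with h | h
    · exact ⟨-1, by simp, by linarith⟩
    · exact ⟨1, by simp, by linarith⟩
  choose σ hσ1 hσ using hσ
  let U : M → Set M := fun p => {q | q ∈ (chart p).source ∧ 0 < σ p * chartArea x N p q}
  have hU : ∀ p, IsOpen (U p) := fun p => isOpen_chartArea_pos hx hN p (σ p)
  obtain ⟨t, ht⟩ := CompactSpace.elim_nhds_subcover U fun p =>
    (hU p).mem_nhds ⟨mem_extChartAt_source p, hσ p⟩
  obtain ⟨ρ, hρ⟩ := SmoothPartitionOfUnity.exists_isSubordinate (𝓡∂ 2) isClosed_univ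
    (fun p : t => U p) (fun p => hU p) (by
      intro q _
      have hq : q ∈ ⋃ p ∈ t, U p := by rw [ht]; trivial
      simpa using hq)
  have hρs : ∀ i, ContMDiff (𝓡∂ 2) 𝓘(ℝ, ℝ) ∞ (ρ i) := fun i => (ρ i).contMDiff
  have hρ1 : ∀ q, ∑ i, ρ i q = 1 := by
    intro q
    rw [← finsum_eq_sum_of_fintype]; exact ρ.sum_eq_one (mem_univ q)
  have hρt : ∀ i, ∀ q ∈ tsupport (ρ i), q ∈ (chart (i : M)).source ∧
      0 < σ i * chartArea x N i q := fun i q hq => hρ i hq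
  let g : t → M → ℝ := fun i => wedgeDensity x N F (ρ i)
  have hg0 : ∀ i, ∀ q ∉ tsupport (ρ i), g i q = 0 := fun i q hq => wedgeDensity_eq_zero _ _ _ hq
  have hgsum : ∀ q, ∑ i, g i q = 0 := by
    intro q
    have h := sum_diff_eq_zero hρs hρ1 q
    have hv : ∀ v, ∑ i, diff (ρ i) q v = 0 := fun v => by
      rw [← sum_apply, h, zero_apply]
    simp only [g, wedgeDensity]
    rw [← Finset.sum_div]
    simp only [wedge]
    rw [Finset.sum_sub_distrib, ← Finset.sum_mul, ← Finset.sum_mul, hv, hv]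
    simp
  have hcont : ∀ i j p, ContinuousOn ((fun q => ρ j q * g i q) ∘ (chart p).symm)
      (chart p).target := fun i j p =>
    ((ρ j).contMDiff.continuous.comp_continuousOn (continuousOn_extChartAt_symm p)).mul
      (continuousOn_wedgeDensity hx hN hF.continuous ha (hρs i) p)
  have hcomp : ∀ i, IsCompact (tsupport (ρ i)) := fun i => (isClosed_tsupport _).isCompact
  have hsrc : ∀ i, tsupport (ρ i) ⊆ (chart (i : M)).source := fun i q hq => (hρt i q hq).1
  have hlocal : ∀ i, P.integral (fun k s => ρ i (P.γ k s) * inner ℝ (F (P.γ k s)) (P.α' k s)) =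
      areaIntegral x N i (g i) := fun i => by
    rw [P.integral_eq_chart_integral hx hF.continuous (ρ i).contMDiff.continuous (hσ1 i) (hρt i),
      areaIntegral_wedgeDensity hx hF ha hcl (hρs i) (hσ1 i) (hρt i)]
  calc P.integral (fun k s => inner ℝ (F (P.γ k s)) (P.α' k s))
      = P.integral (fun k s => ∑ i, ρ i (P.γ k s) * inner ℝ (F (P.γ k s)) (P.α' k s)) := by
        simp only [← Finset.sum_mul, hρ1, one_mul]
    _ = ∑ i : t, areaIntegral x N i (g i) := by
        rw [P.integral_sum]
        · exact Finset.sum_congr rfl fun i _ => hlocal i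
        · exact fun i k => ((ρ i).contMDiff.continuous.comp (P.continuous_γ k)).mul
            ((hF.continuous.comp (P.continuous_γ k)).inner (P.continuous_α' hx k))
    _ = ∑ i : t, ∑ j : t, areaIntegral x N i (fun q => ρ j q * g i q) := by
        refine Finset.sum_congr rfl fun i _ => ?_
        rw [← areaIntegral_sum]
        · simp only [← Finset.sum_mul, hρ1, one_mul]
        · exact fun j => integrableOn_chart hx hN i (hcomp i) (hsrc i) (hcont i j i) fun q hq => by
            rw [hg0 i q hq, mul_zero]
    -- The product ρⱼgᵢ is supported in both charts, so its integral can be moved from chart i to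
    -- chart j. In chart j the sum of the gᵢ is taken pointwise and vanishes.
    _ = ∑ j : t, ∑ i : t, areaIntegral x N j (fun q => ρ j q * g i q) := by
        rw [Finset.sum_comm]
        refine Finset.sum_congr rfl fun j _ => Finset.sum_congr rfl fun i _ => ?_
        refine areaIntegral_eq_of_support (i : M) (j : M) _ fun q hq => ⟨hsrc i ?_, hsrc j ?_⟩
        · by_contra h
          exact hq (by rw [hg0 i q h, mul_zero])
        · by_contra h
          exact hq (by rw [image_eq_zero_of_notMem_tsupport h, zero_mul])
    _ = 0 := by
        refine Finset.sum_eq_zero fun j _ => ?_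
        rw [← areaIntegral_sum]
        · simp only [← Finset.mul_sum, hgsum, mul_zero, areaIntegral, zero_mul, integral_zero]
        · exact fun i => integrableOn_chart hx hN j (hcomp j) (hsrc j) (hcont i j j) fun q hq => by
            rw [image_eq_zero_of_notMem_tsupport hq, zero_mul]

end Global

/-! ### The Gauss map and the shape operator. -/

section Geometry

lemma inner_space (u v : Space) : (inner ℝ u v : ℝ) = u 0 * v 0 + u 1 * v 1 + u 2 * v 2 := by
  simp [PiLp.inner_apply, Fin.sum_univ_three]; ring

/-- Lagrange's identity. -/
lemma inner_cross_cross (u v : Space) : (inner ℝ (cross u v) (cross u v) : ℝ) =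
    inner ℝ u u * inner ℝ v v - inner ℝ u v ^ 2 := by
  simp only [inner_space, cross, cross_apply]
  simp
  ring

lemma inner_cross_self_left (u v : Space) : (inner ℝ (cross u v) u : ℝ) = 0 := by
  rw [inner_cross]; ring

lemma inner_cross_self_right (u v : Space) : (inner ℝ (cross u v) v : ℝ) = 0 := by
  rw [inner_cross]; ring

/-- The Gram determinant of two independent vectors is positive. -/
lemma gram_pos {u v : Space} (h : ∀ c d : ℝ, c • u + d • v = 0 → c = 0 ∧ d = 0) :
    0 < (inner ℝ u u * inner ℝ v v - inner ℝ u v ^ 2 : ℝ) := by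
  have hu : 0 < (inner ℝ u u : ℝ) := by
    rw [real_inner_self_pos]
    rintro rfl
    simpa using (h 1 0 (by simp)).1
  -- The squared norm of this vector is ⟨u, u⟩ times the Gram determinant.
  have hw : 0 < (inner ℝ ((inner ℝ u u : ℝ) • v - (inner ℝ u v : ℝ) • u)
      ((inner ℝ u u : ℝ) • v - (inner ℝ u v : ℝ) • u) : ℝ) := by
    rw [real_inner_self_pos]
    intro h0
    exact hu.ne' (h (-inner ℝ u v) (inner ℝ u u) (by rw [← h0]; module)).2
  simp only [inner_sub_left, inner_sub_right, real_inner_smul_left, real_inner_smul_right,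
    real_inner_comm u v] at hw
  by_contra! hle
  nlinarith [mul_nonneg hu.le (neg_nonneg.2 hle)]

/-- A vector that is orthogonal to `u`, `v` and `n`, where `n` is a normal of the plane of `u` and
`v`, vanishes. -/
lemma eq_zero_of_inner_eq_zero {u v n w : Space} (h : (inner ℝ (cross u v) n : ℝ) ≠ 0)
    (hu : (inner ℝ u w : ℝ) = 0) (hv : (inner ℝ v w : ℝ) = 0) (hn : (inner ℝ n w : ℝ) = 0) :
    w = 0 := by
  rw [inner_cross] at h
  rw [inner_space] at hu hv hn
  -- Cramer's rule: the coefficients are the components of v ∧ n, n ∧ u and u ∧ v, the cofactors of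
  -- the nonzero determinant of (u, v, n).
  have h0 : w 0 = 0 := by
    refine (mul_eq_zero.1 (?_ : _ * w 0 = 0)).resolve_left h
    linear_combination (v 1 * n 2 - v 2 * n 1) * hu + (n 1 * u 2 - n 2 * u 1) * hv +
      (u 1 * v 2 - u 2 * v 1) * hn
  have h1 : w 1 = 0 := by
    refine (mul_eq_zero.1 (?_ : _ * w 1 = 0)).resolve_left h
    linear_combination (v 2 * n 0 - v 0 * n 2) * hu + (n 2 * u 0 - n 0 * u 2) * hv +
      (u 2 * v 0 - u 0 * v 2) * hn
  have h2 : w 2 = 0 := by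
    refine (mul_eq_zero.1 (?_ : _ * w 2 = 0)).resolve_left h
    linear_combination (v 0 * n 1 - v 1 * n 0) * hu + (n 0 * u 1 - n 1 * u 0) * hv +
      (u 0 * v 1 - u 1 * v 0) * hn
  ext i; fin_cases i <;> assumption

variable {M : Type*} [TopologicalSpace M] [ChartedSpace (EuclideanHalfSpace 2) M]
  {x N : M → Space} {a b : ℝ}

lemma coordVec_eq (x : M → Space) (p : M) (i : Fin 2) : coordVec x p i = diff x p (stdVec i) := rfl

namespace IsStationaryRotating

lemma gram_pos (h : IsStationaryRotating x N a b) (p : M) :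
    0 < (inner ℝ (diff x p (stdVec 0)) (diff x p (stdVec 0)) *
      inner ℝ (diff x p (stdVec 1)) (diff x p (stdVec 1)) -
      inner ℝ (diff x p (stdVec 0)) (diff x p (stdVec 1)) ^ 2 : ℝ) := by
  refine RotatingSurface.gram_pos fun c d hcd => ?_
  rw [← map_smul, ← map_smul, ← map_add] at hcd
  have hz : c • stdVec 0 + d • stdVec 1 = 0 := h.immersion p (hcd.trans (map_zero (diff x p)).symm)
  exact ⟨by simpa using congrArg (fun v : Plane => v 0) hz,
    by simpa using congrArg (fun v : Plane => v 1) hz⟩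

lemma inner_normal (h : IsStationaryRotating x N a b) (p : M) (v : Plane) :
    (inner ℝ (N p) (diff x p v) : ℝ) = 0 := h.gauss_normal p v

/-- Otherwise the unit vector `N p` would be orthogonal to dx(e₀), dx(e₁) and their vector product,
which span the space. -/
lemma areaForm_ne_zero (h : IsStationaryRotating x N a b) (p : M) :
    areaForm (diff x p) (N p) ≠ 0 := by
  have hg := h.gram_pos p
  rw [← inner_cross_cross] at hg
  intro h0
  set u := diff x p (stdVec 0)
  set v := diff x p (stdVec 1)
  have hN : (inner ℝ (N p) (N p) : ℝ) = 1 := by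
    rw [real_inner_self_eq_norm_sq, h.gauss_unit]; norm_num
  have hu := h.inner_normal p (stdVec 0)
  have hv := h.inner_normal p (stdVec 1)
  have hn : (inner ℝ (cross u v) (cross u v) : ℝ) ≠ 0 := hg.ne'
  have : N p = 0 := by
    refine eq_zero_of_inner_eq_zero hn ?_ ?_ h0
    · rw [real_inner_comm]; exact hu
    · rw [real_inner_comm]; exact hv
  rw [this] at hN
  simp at hN

/-- Differentiate ⟨N, N⟩ = 1. -/
lemma inner_normal_diff_normal [IsManifold (𝓡∂ 2) ∞ M] (h : IsStationaryRotating x N a b) (p : M)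
    (v : Plane) : (inner ℝ (N p) (diff N p v) : ℝ) = 0 := by
  have hp := mem_extChartAt_source (I := 𝓡∂ 2) p
  have h1 := hasFDerivWithinAt_comp_chart_symm hp (h.gauss_smooth.mdifferentiable (by simp) p)
  rw [chartInv_self, ContinuousLinearMap.comp_id] at h1
  have h2 := h1.inner ℝ h1
  have h3 : (fun y => (inner ℝ ((N ∘ (chart p).symm) y) ((N ∘ (chart p).symm) y) : ℝ)) =
      fun _ => 1 := by
    funext y
    rw [real_inner_self_eq_norm_sq, Function.comp_apply, h.gauss_unit]; norm_num
  rw [h3] at h2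
  have h4 := ((𝓡∂ 2).uniqueDiffOn _ (mem_range_self _)).eq h2 (hasFDerivWithinAt_const _ _ _)
  have h5 := DFunLike.congr_fun h4 v
  simp only [ContinuousLinearMap.comp_apply, ContinuousLinearMap.prod_apply, fderivInnerCLM_apply,
    Function.comp_apply, (chart p).left_inv hp, zero_apply] at h5
  rw [real_inner_comm (N p)] at h5
  linarith

/-- The trace of the shape operator, as an identity between vector products. -/
lemma cross_diff_normal [IsManifold (𝓡∂ 2) ∞ M] (h : IsStationaryRotating x N a b) (p : M)
    (w : Space) :
    (inner ℝ (cross (diff N p (stdVec 0)) (diff x p (stdVec 1))) w : ℝ) -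
      inner ℝ (cross (diff N p (stdVec 1)) (diff x p (stdVec 0))) w =
    -(a * axisDist (x p) ^ 2 + b) *
      inner ℝ (cross (diff x p (stdVec 0)) (diff x p (stdVec 1))) w := by
  have hg := h.gram_pos p
  have hl := h.laplace p
  rw [← hl]
  have ha : (inner ℝ (cross (diff x p (stdVec 0)) (diff x p (stdVec 1))) (N p) : ℝ) ≠ 0 :=
    h.areaForm_ne_zero p
  have hNu := h.inner_normal p (stdVec 0)
  have hNv := h.inner_normal p (stdVec 1)
  have hNm := h.inner_normal_diff_normal p (stdVec 0)
  have hNn := h.inner_normal_diff_normal p (stdVec 1)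
  have hH : meanCurvature x N p = (1 / 2) *
      ((firstFundamentalForm x p)⁻¹ * secondFundamentalForm x N p).trace := rfl
  rw [Matrix.inv_def, Matrix.det_fin_two, Matrix.adjugate_fin_two, Ring.inverse_eq_inv',
    Matrix.trace_fin_two] at hH
  simp only [firstFundamentalForm, secondFundamentalForm, coordVec_eq, Matrix.of_apply,
    Matrix.smul_apply, Matrix.mul_apply, Fin.sum_univ_two, smul_eq_mul,
    Matrix.cons_val_zero, Matrix.cons_val_one, Matrix.cons_val_fin_one, Matrix.cons_val'] at hH
  set u := diff x p (stdVec 0)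
  set v := diff x p (stdVec 1)
  set m := diff N p (stdVec 0)
  set n := diff N p (stdVec 1)
  rw [real_inner_comm u v] at hH
  set E : ℝ := inner ℝ u u
  set F : ℝ := inner ℝ u v
  set G : ℝ := inner ℝ v v
  have hD : E * G - F ^ 2 ≠ 0 := hg.ne'
  -- A tangent vector is expanded in the basis (u, v) by the inverse of the Gram matrix.
  have hspan : ∀ z : Space, (inner ℝ (N p) z : ℝ) = 0 →
      z = ((G * inner ℝ u z - F * inner ℝ v z) / (E * G - F ^ 2)) • u +
        ((E * inner ℝ v z - F * inner ℝ u z) / (E * G - F ^ 2)) • v := by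
    intro z hz
    rw [← sub_eq_zero]
    refine eq_zero_of_inner_eq_zero ha ?_ ?_ ?_
    · simp only [inner_sub_right, inner_add_right, real_inner_smul_right]
      change _ - (_ * E + _ * F) = 0
      linear_combination (-(inner ℝ u z : ℝ)) * mul_inv_cancel₀ hD
    · simp only [inner_sub_right, inner_add_right, real_inner_smul_right, real_inner_comm u v]
      change _ - (_ * F + _ * G) = 0
      linear_combination (-(inner ℝ v z : ℝ)) * mul_inv_cancel₀ hD
    · simp only [inner_sub_right, inner_add_right, real_inner_smul_right, hz, hNu, hNv]
      ring
  have hm := hspan m hNm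
  have hn := hspan n hNn
  have hH2 : 2 * meanCurvature x N p = -((G * inner ℝ u m - F * inner ℝ v m) / (E * G - F ^ 2) +
      (E * inner ℝ v n - F * inner ℝ u n) / (E * G - F ^ 2)) := by
    rw [hH, real_inner_comm m u, real_inner_comm m v, real_inner_comm n u, real_inner_comm n v]
    rw [show E * G - F * F = E * G - F ^ 2 by ring]
    field_simp; ring
  rw [hH2]
  set s₁ := (G * inner ℝ u m - F * inner ℝ v m) / (E * G - F ^ 2)
  set s₂ := (E * inner ℝ v m - F * inner ℝ u m) / (E * G - F ^ 2)
  set t₁ := (G * inner ℝ u n - F * inner ℝ v n) / (E * G - F ^ 2)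
  set t₂ := (E * inner ℝ v n - F * inner ℝ u n) / (E * G - F ^ 2)
  -- With m = s₁u + s₂v and n = t₁u + t₂v, m ∧ v − n ∧ u = (s₁ + t₂) u ∧ v, and s₁ + t₂ = −2H by
  -- `hH2`.
  rw [hm, hn]
  simp only [inner_cross, PiLp.add_apply, PiLp.smul_apply, smul_eq_mul]
  ring

end IsStationaryRotating

end Geometry

/-! ### The closed 1-form and its values on the boundary. -/

section Flux

lemma axisDist_sq (q : Space) : axisDist q ^ 2 = q 0 ^ 2 + q 1 ^ 2 :=
  Real.sq_sqrt (by positivity)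

lemma inner_cross_E₃ (u v : Space) : (inner ℝ (cross u v) E₃ : ℝ) = u 0 * v 1 - u 1 * v 0 := by
  rw [inner_cross]; simp [E₃]

/-- The vector `E₃ ∧ ((a r² + 2 b) q + 4 n)`. -/
def flux (a b : ℝ) (z : Space × Space) : Space :=
  !₂[-((a * (z.1 0 ^ 2 + z.1 1 ^ 2) + 2 * b) * z.1 1 + 4 * z.2 1),
    (a * (z.1 0 ^ 2 + z.1 1 ^ 2) + 2 * b) * z.1 0 + 4 * z.2 0, 0]

/-- Cyclic symmetry of the triple product: ⟨E₃ ∧ q, v⟩ = ⟨q ∧ v, E₃⟩. -/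
lemma inner_flux (a b : ℝ) (q n v : Space) : (inner ℝ (flux a b (q, n)) v : ℝ) =
    (a * axisDist q ^ 2 + 2 * b) * inner ℝ (cross q v) E₃ + 4 * inner ℝ (cross n v) E₃ := by
  rw [inner_cross_E₃, inner_cross_E₃, axisDist_sq, inner_space]
  simp [flux]; ring

lemma contDiff_flux (a b : ℝ) : ContDiff ℝ ∞ (flux a b) := by
  rw [contDiff_euclidean]
  intro i
  fin_cases i <;> simp [flux] <;> fun_prop

lemma flux_zero (a b : ℝ) (q n : Space) : flux a b (q, n) 0 =
    -((a * (q 0 ^ 2 + q 1 ^ 2) + 2 * b) * q 1 + 4 * n 1) := by simp [flux]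

lemma flux_one (a b : ℝ) (q n : Space) : flux a b (q, n) 1 =
    (a * (q 0 ^ 2 + q 1 ^ 2) + 2 * b) * q 0 + 4 * n 0 := by simp [flux]

lemma flux_two (a b : ℝ) (q n : Space) : flux a b (q, n) 2 = 0 := by simp [flux]

variable {M : Type*} [TopologicalSpace M] [ChartedSpace (EuclideanHalfSpace 2) M]
  {x N : M → Space} {a b : ℝ}

/-- The field `E₃ ∧ ((a r² + 2 b) x + 4 N)` along a surface. -/
def fluxField (x N : M → Space) (a b : ℝ) (p : M) : Space := flux a b (x p, N p)

lemma contMDiff_fluxField (hx : ContMDiff (𝓡∂ 2) 𝓘(ℝ, Space) ∞ x)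
    (hN : ContMDiff (𝓡∂ 2) 𝓘(ℝ, Space) ∞ N) :
    ContMDiff (𝓡∂ 2) 𝓘(ℝ, Space) ∞ (fluxField x N a b) :=
  (contDiff_flux a b).contMDiff.comp (hx.prodMk_space hN)

namespace BoundaryParametrization

variable (P : BoundaryParametrization x N)

lemma norm_α' (k : Fin P.n) (s : ℝ) : ‖P.α' k s‖ = 1 := P.unit_speed k s

lemma norm_ν (k : Fin P.n) (s : ℝ) : ‖P.ν k s‖ = 1 := by
  have ho := P.oriented k s
  have h : ∃ w : Space, inwardConormal x (P.γ k s) = ‖w‖⁻¹ • w := ⟨_, rfl⟩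
  obtain ⟨w, hw⟩ := h
  -- For `w = 0` the normalization would return 0, against the strict inequality in `oriented`.
  have h0 : w ≠ 0 := by
    rintro rfl
    rw [hw] at ho
    simp [inner_cross] at ho
  rw [ν, hw, norm_smul, norm_inv, norm_norm, inv_mul_cancel₀ (norm_ne_zero_iff.2 h0)]

lemma continuous_α (hx : Continuous x) (k : Fin P.n) : Continuous (P.α k) :=
  hx.comp (P.continuous_γ k)

lemma continuous_inner_cross_E₃ {α : Type*} [TopologicalSpace α] {u v : α → Space}
    (hu : Continuous u) (hv : Continuous v) :
    Continuous fun t => (inner ℝ (cross (u t) (v t)) E₃ : ℝ) := by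
  simp only [inner_cross_E₃]
  fun_prop

lemma integral_add {f g : Fin P.n → ℝ → ℝ} (hf : ∀ k, Continuous (f k))
    (hg : ∀ k, Continuous (g k)) :
    P.integral (fun k s => f k s + g k s) = P.integral f + P.integral g := by
  simp only [integral]
  rw [← Finset.sum_add_distrib]
  exact Finset.sum_congr rfl fun k _ => intervalIntegral.integral_add
    ((hf k).intervalIntegrable _ _) ((hg k).intervalIntegrable _ _)

lemma integral_const_mul (c : ℝ) (f : Fin P.n → ℝ → ℝ) :
    P.integral (fun k s => c * f k s) = c * P.integral f := by
  simp only [integral, intervalIntegral.integral_const_mul, Finset.mul_sum]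

lemma neg_length_le {f : Fin P.n → ℝ → ℝ} (hf : ∀ k, Continuous (f k)) (h1 : ∀ k s, -1 ≤ f k s) :
    -P.length ≤ P.integral f := by
  have h : P.integral (fun _ _ => -1) ≤ P.integral f :=
    Finset.sum_le_sum fun k _ => intervalIntegral.integral_mono (P.ℓ_pos k).le
      (continuous_const.intervalIntegrable _ _) ((hf k).intervalIntegrable _ _) (h1 k)
  have h2 := P.integral_const_mul (-1) fun _ _ => 1
  simp only [mul_one] at h2
  rw [h2] at h
  rw [length]
  linarith

end BoundaryParametrization

variable [IsManifold (𝓡∂ 2) ∞ M]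

lemma hasFDerivWithinAt_coord {h : M → Space} (hh : ContMDiff (𝓡∂ 2) 𝓘(ℝ, Space) ∞ h) (p : M)
    (i : Fin 3) : HasFDerivWithinAt (fun y => h ((chart p).symm y) i)
      ((EuclideanSpace.proj i : Space →L[ℝ] ℝ).comp (diff h p)) (range (𝓡∂ 2)) (chart p p) := by
  have h1 := hasFDerivWithinAt_comp_chart_symm (mem_extChartAt_source (I := 𝓡∂ 2) p)
    (hh.mdifferentiable (by simp) p)
  rw [chartInv_self, ContinuousLinearMap.comp_id] at h1
  exact (EuclideanSpace.proj i : Space →L[ℝ] ℝ).hasFDerivAt.comp_hasFDerivWithinAt _ h1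

lemma diff_fluxField (hx : ContMDiff (𝓡∂ 2) 𝓘(ℝ, Space) ∞ x)
    (hN : ContMDiff (𝓡∂ 2) 𝓘(ℝ, Space) ∞ N) (p : M) (v : Plane) :
    diff (fluxField x N a b) p v 0 =
      -(2 * a * (x p 0 * diff x p v 0 + x p 1 * diff x p v 1) * x p 1 +
        (a * (x p 0 ^ 2 + x p 1 ^ 2) + 2 * b) * diff x p v 1 + 4 * diff N p v 1) ∧
    diff (fluxField x N a b) p v 1 =
      2 * a * (x p 0 * diff x p v 0 + x p 1 * diff x p v 1) * x p 0 +
        (a * (x p 0 ^ 2 + x p 1 ^ 2) + 2 * b) * diff x p v 0 + 4 * diff N p v 0 ∧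
    diff (fluxField x N a b) p v 2 = 0 := by
  have hu : UniqueDiffWithinAt ℝ (range (𝓡∂ 2)) (chart p p) :=
    (𝓡∂ 2).uniqueDiffOn _ (mem_range_self _)
  have hF := hasFDerivWithinAt_coord (contMDiff_fluxField (a := a) (b := b) hx hN) p
  have hX := hasFDerivWithinAt_coord hx p
  have hn := hasFDerivWithinAt_coord hN p
  have hinv := (chart p).left_inv (mem_extChartAt_source (I := 𝓡∂ 2) p)
  have hρ := ((((hX 0).pow 2).add ((hX 1).pow 2)).const_mul a).add_const (2 * b)
  have h0 := hF 0
  have h1 := hF 1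
  have h2 := hF 2
  simp only [fluxField, flux_zero] at h0
  simp only [fluxField, flux_one] at h1
  simp only [fluxField, flux_two] at h2
  have e0 := DFunLike.congr_fun (hu.eq h0 ((hρ.mul (hX 1)).add ((hn 1).const_mul 4)).neg) v
  have e1 := DFunLike.congr_fun (hu.eq h1 ((hρ.mul (hX 0)).add ((hn 0).const_mul 4))) v
  have e2 := DFunLike.congr_fun (hu.eq h2 (hasFDerivWithinAt_const _ _ _)) v
  simp only [ContinuousLinearMap.comp_apply, add_apply, neg_apply, smul_apply, zero_apply,
    smul_eq_mul, hinv, Pi.add_apply, PiLp.proj_apply, nsmul_eq_mul, Nat.cast_ofNat,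
    Nat.add_one_sub_one, pow_one] at e0 e1 e2
  refine ⟨?_, ?_, ?_⟩
  · rw [e0]; ring
  · rw [e1]; ring
  · exact e2

/-- The 1-form `⟨E₃ ∧ ((a r² + 2 b) x + 4 N), dx⟩` is closed on a stationary rotating surface. -/
lemma IsStationaryRotating.fluxField_closed (h : IsStationaryRotating x N a b) (p : M) :
    (inner ℝ (diff (fluxField x N a b) p (stdVec 0)) (diff x p (stdVec 1)) : ℝ) =
      inner ℝ (diff (fluxField x N a b) p (stdVec 1)) (diff x p (stdVec 0)) := by
  obtain ⟨u0, u1, u2⟩ := diff_fluxField (a := a) (b := b) h.smooth h.gauss_smooth p (stdVec 0)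
  obtain ⟨v0, v1, v2⟩ := diff_fluxField (a := a) (b := b) h.smooth h.gauss_smooth p (stdVec 1)
  have hc := h.cross_diff_normal p E₃
  rw [inner_cross_E₃, inner_cross_E₃, inner_cross_E₃, axisDist_sq] at hc
  rw [inner_space, inner_space, u0, u1, u2, v0, v1, v2]
  -- The derivative of r² doubles the term a r², so the position part contributes 4(a r² + b) dx₁ ∧
  -- dx₂: this is why the form carries 2b next to a r², and the factor 4 on N.
  linear_combination 4 * hc

/-- The inward conormal is `N ∧ α'`. -/
lemma BoundaryParametrization.ν_eq (P : BoundaryParametrization x N)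
    (h : IsStationaryRotating x N a b) (k : Fin P.n) (s : ℝ) :
    P.ν k s = cross (N (P.γ k s)) (P.α' k s) := by
  have ho : 0 < inner ℝ (cross (-P.ν k s) (P.α' k s)) (N (P.γ k s)) := P.oriented k s
  have hα : P.α' k s = P.velocity k s 1 • diff x (P.γ k s) (stdVec 1) := by
    rw [P.α'_eq h.smooth, ← map_smul, ← P.velocity_eq]
  have hν : ∃ c μ : ℝ, P.ν k s =
      c • (diff x (P.γ k s) (stdVec 0) - μ • diff x (P.γ k s) (stdVec 1)) ∧
      μ = inner ℝ (diff x (P.γ k s) (stdVec 1)) (diff x (P.γ k s) (stdVec 0)) /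
        inner ℝ (diff x (P.γ k s) (stdVec 1)) (diff x (P.γ k s) (stdVec 1)) := ⟨_, _, rfl, rfl⟩
  obtain ⟨c, μ, hν, hμ⟩ := hν
  have hg := h.gram_pos (P.γ k s)
  have hN0 := h.inner_normal (P.γ k s) (stdVec 0)
  have hN1 := h.inner_normal (P.γ k s) (stdVec 1)
  have hNN : (inner ℝ (N (P.γ k s)) (N (P.γ k s)) : ℝ) = 1 := by
    rw [real_inner_self_eq_norm_sq, h.gauss_unit]; norm_num
  have hαα : (inner ℝ (P.α' k s) (P.α' k s) : ℝ) = 1 := by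
    rw [real_inner_self_eq_norm_sq, P.norm_α']; norm_num
  have hνν : (inner ℝ (P.ν k s) (P.ν k s) : ℝ) = 1 := by
    rw [real_inner_self_eq_norm_sq, P.norm_ν]; norm_num
  set u := diff x (P.γ k s) (stdVec 0)
  set v := diff x (P.γ k s) (stdVec 1)
  have hNα : (inner ℝ (N (P.γ k s)) (P.α' k s) : ℝ) = 0 := by
    rw [hα, real_inner_smul_right, hN1, mul_zero]
  have hNν : (inner ℝ (N (P.γ k s)) (P.ν k s) : ℝ) = 0 := by
    rw [hν, real_inner_smul_right, inner_sub_right, real_inner_smul_right, hN0, hN1]; ring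
  have hvv : (inner ℝ v v : ℝ) ≠ 0 := by
    intro h0
    rw [h0] at hg
    nlinarith [sq_nonneg (inner ℝ u v : ℝ)]
  have hαν : (inner ℝ (P.α' k s) (P.ν k s) : ℝ) = 0 := by
    rw [hα, hν, real_inner_smul_right, real_inner_smul_left, inner_sub_right,
      real_inner_smul_right, hμ, div_mul_cancel₀ _ hvv, sub_self]
    simp
  set n := N (P.γ k s)
  set τ := P.α' k s
  set η := P.ν k s
  have hcc : (inner ℝ (cross n τ) (cross n τ) : ℝ) = 1 := by
    rw [inner_cross_cross, hNN, hαα, hNα]; norm_num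
  have hpos : 0 < (inner ℝ (cross n τ) η : ℝ) := by
    have : (inner ℝ (cross (-η) τ) n : ℝ) = inner ℝ (cross n τ) η := by
      simp only [inner_cross, PiLp.neg_apply]; ring
    rwa [this] at ho
  -- The conormal is orthogonal to n and τ, hence a multiple of the unit vector n ∧ τ. Its unit
  -- length and the orientation force the factor to be 1.
  have hη : η = (inner ℝ (cross n τ) η : ℝ) • cross n τ := by
    rw [← sub_eq_zero]
    refine eq_zero_of_inner_eq_zero (u := n) (v := τ) (n := cross n τ) (by rw [hcc]; norm_num)
      ?_ ?_ ?_
    · rw [inner_sub_right, real_inner_smul_right, real_inner_comm (cross n τ) n,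
        inner_cross_self_left, hNν]; ring
    · rw [inner_sub_right, real_inner_smul_right, real_inner_comm (cross n τ) τ,
        inner_cross_self_right, hαν]; ring
    · rw [inner_sub_right, real_inner_smul_right, hcc]; ring
  have hd : (inner ℝ (cross n τ) η : ℝ) = 1 := by
    have h1 := hνν
    rw [hη, real_inner_smul_left, real_inner_smul_right, hcc] at h1
    nlinarith
  rw [hη, hd, one_smul]

end Flux

end RotatingSurface

end

/-! ### The integral identity and the inequality. -/

theorem mainTheorem4 {M : Type*} [TopologicalSpace M] [ChartedSpace (EuclideanHalfSpace 2) M]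
    [IsManifold (𝓡∂ 2) ∞ M] [T2Space M] [CompactSpace M] [ConnectedSpace M]
    (x N : M → RotatingSurface.Space) (a b : ℝ)
    (hM : RotatingSurface.IsStationaryRotating x N a b)
    (hne : ((𝓡∂ 2).boundary M).Nonempty)
    (P : RotatingSurface.BoundaryParametrization x N) :
    P.integral (fun i s =>
        (a * RotatingSurface.axisDist (P.α i s) ^ 2 + 2 * b) *
          inner ℝ (RotatingSurface.cross (P.α i s) (P.α' i s)) RotatingSurface.E₃) =
      -4 * P.integral (fun i s => inner ℝ (P.ν i s) RotatingSurface.E₃) ∧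
    a * P.integral (fun i s =>
        RotatingSurface.axisDist (P.α i s) ^ 2 *
          inner ℝ (RotatingSurface.cross (P.α i s) (P.α' i s)) RotatingSurface.E₃) ≤
      4 * (P.length - b * P.algebraicArea) := by
  open RotatingSurface RotatingSurface.BoundaryParametrization in
  have hr : ∀ k, Continuous fun s => axisDist (P.α k s) ^ 2 := fun k => by
    have := P.continuous_α hM.smooth.continuous k
    simp only [axisDist_sq]
    fun_prop
  have hcα : ∀ k, Continuous fun s => (inner ℝ (cross (P.α k s) (P.α' k s)) E₃ : ℝ) := fun k =>
    continuous_inner_cross_E₃ (P.continuous_α hM.smooth.continuous k) (P.continuous_α' hM.smooth k)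
  -- The conormal is defined through preferred charts that vary with the point; its continuity is
  -- read off from ν = N ∧ α'.
  have hcν : ∀ k, Continuous fun s => (inner ℝ (P.ν k s) E₃ : ℝ) := fun k => by
    simp only [P.ν_eq hM]
    exact continuous_inner_cross_E₃ (hM.gauss_smooth.continuous.comp (P.continuous_γ k))
      (P.continuous_α' hM.smooth k)
  have hStokes := P.integral_closed_oneForm hM.smooth hM.gauss_smooth.continuous
    (contMDiff_fluxField (a := a) (b := b) hM.smooth hM.gauss_smooth) hM.areaForm_ne_zero
    hM.fluxField_closed
  have hform : ∀ k s, (inner ℝ (fluxField x N a b (P.γ k s)) (P.α' k s) : ℝ) =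
      (a * axisDist (P.α k s) ^ 2 + 2 * b) * inner ℝ (cross (P.α k s) (P.α' k s)) E₃ +
        4 * inner ℝ (P.ν k s) E₃ := fun k s => by
    rw [P.ν_eq hM]; exact inner_flux a b _ _ _
  simp only [hform] at hStokes
  have hcw : ∀ k, Continuous fun s => (a * axisDist (P.α k s) ^ 2 + 2 * b) *
      (inner ℝ (cross (P.α k s) (P.α' k s)) E₃ : ℝ) := fun k =>
    (((hr k).const_mul a).add continuous_const).mul (hcα k)
  rw [P.integral_add hcw (fun k => (hcν k).const_mul 4), P.integral_const_mul] at hStokes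
  have hfirst : P.integral (fun k s => (a * axisDist (P.α k s) ^ 2 + 2 * b) *
      inner ℝ (cross (P.α k s) (P.α' k s)) E₃) =
      -4 * P.integral (fun k s => inner ℝ (P.ν k s) E₃) := by linarith
  refine ⟨hfirst, ?_⟩
  have hca : ∀ k, Continuous fun s => a * (axisDist (P.α k s) ^ 2 *
      (inner ℝ (cross (P.α k s) (P.α' k s)) E₃ : ℝ)) := fun k =>
    ((hr k).mul (hcα k)).const_mul a
  have hsplit : P.integral (fun k s => (a * axisDist (P.α k s) ^ 2 + 2 * b) *
      inner ℝ (cross (P.α k s) (P.α' k s)) E₃) =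
      a * P.integral (fun k s => axisDist (P.α k s) ^ 2 *
        inner ℝ (cross (P.α k s) (P.α' k s)) E₃) + 4 * (b * P.algebraicArea) := by
    rw [algebraicArea, ← P.integral_const_mul a,
      show ∀ z : ℝ, 4 * (b * (1 / 2 * z)) = 2 * b * z by intro z; ring, ← P.integral_const_mul (2 * b),
      ← P.integral_add hca (fun k => (hcα k).const_mul (2 * b))]
    congr 1
    funext k s
    ring
  -- Cauchy–Schwarz for the unit vectors ν and E₃ gives ν₃ ≥ −1.
  have hlow := P.neg_length_le hcν fun k s => by
    have h := abs_real_inner_le_norm (P.ν k s) E₃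
    have hE : ‖E₃‖ = 1 := by simp [E₃]
    rw [P.norm_ν, hE, mul_one] at h
    exact (abs_le.1 h).1
  linarith
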